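/- Let $K$ be a field of characteristic $0$. For $\pi\in S_n$ write $i\pi$ for the image of $i$, and call $(1\pi)(2\pi)\cdots(n\pi)$ the image line of $\pi$. Let $KS=\bigoplus_{n\ge 0}KS_n$ be the $K$-vector space with basis the disjoint union of all symmetric groups $S_n$ ($n\ge0$), let $\emptyset\in S_0$ be the empty permutation, and let $\mathbb N$ be the set of positive integers. The standardization of a word with distinct letters is the permutation whose image line has the same length and the same relative order of letters. Equip $KS$ with the Malvenuto–Reutenauer operations: for $\sigma\in S_n$, $\tau\in S_m$ the outer product $\sigma\star\tau$ is the sum of all $w\in S_{n+m}$ whose image line is a concatenation $uv$ such that $u$ has standardization $\sigma$ and $v$ has standardization $\tau$; for $\pi\in S_n$ the coproduct is $\pi{\downarrow}=\sum_{k=0}^n \pi_{\le k}\otimes \pi_{>k}$, where $\pi_{\le k}$ is the subword of the image line of $\pi$ on the letters $1,\dots,k$ and $\pi_{>k}$ is the standardization of the subword on the letters $k+1,\dots,n$. The unit is $\emptyset$, and the counit is the coefficient of $\emptyset$. For $\pi\in S_n$ let $\mathrm{Des}(\pi)=\{i : 1\le i\le n-1,\ i\pi>(i+1)\pi\}$ and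 $\mathrm{Peak}(\pi)=\{i : 2\le i\le n-1,\ (i-1)\pi<i\pi>(i+1)\pi\}$. Let $\mathcal D_n\subseteq KS_n$ be the linear span of the sums $\Delta^D=\sum_{\pi\in S_n,\,\mathrm{Des}(\pi)=D}\pi$, $D\subseteq\{1,\dots,n-1\}$, let $\mathcal P_n\subseteq KS_n$ be the linear span of the sums $\Pi^P=\sum_{\pi\in S_n,\,\mathrm{Peak}(\pi)=P}\pi$, $P\subseteq\{2,\dots,n-1\}$, and put $\mathcal D=\bigoplus_{n\ge0}\mathcal D_n$, $\mathcal P=\bigoplus_{n\ge0}\mathcal P_n$. Let $\tilde\Xi^0=\emptyset$ and $\tilde\Xi^n=2\sum_{\pi\in S_n,\,\mathrm{Peak}(\pi)=\emptyset}\pi$ for $n\ge1$. For a word $q=q_1.\cdots.q_k$ in the free monoid $\mathbb N^*$ over the alphabet $\mathbb N$ let $\tilde\Xi^q=\tilde\Xi^{q_1}\star\cdots\star\tilde\Xi^{q_k}$ (which is $\emptyset$ for the empty word); $q$ is called odd if all $q_i$ are odd, and $r.q$ denotes the concatenation of $r$ and $q$. Then $(\mathcal D,\star,\downarrow)$ is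 a Hopf algebra and $\mathcal P$ is a Hopf subalgebra of it. Furthermore, the elements $\tilde\Xi^q$, $q\in\mathbb N^*$ odd, constitute a linear basis of $\mathcal P$, and $$\tilde\Xi^r\star\tilde\Xi^q=\tilde\Xi^{r.q}\quad\text{for all } q,r\in\mathbb N^*,\qquad \tilde\Xi^n{\downarrow}=\sum_{k=0}^n\tilde\Xi^k\otimes\tilde\Xi^{n-k}\quad\text{for all } n\ge 0.$$ In particular, $(\mathcal P,\star)$ is a polynomial ring over $K$ in the non-commuting variables $\frac12\tilde\Xi^n=\sum_{\pi\in S_n,\,\mathrm{Peak}(\pi)=\emptyset}\pi$, $n\in\mathbb N$ odd; that is, it is the free associative unital $K$-algebra on these elements. -/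

import Mathlib

open scoped TensorProduct

universe u

namespace PeakHopf

/-- The index set of the standard basis of `KS`: the disjoint union of all symmetric groups `S_n`,
`n ≥ 0`. -/
abbrev AllPerm : Type := Σ n : ℕ, Equiv.Perm (Fin n)

/-- `KS = ⊕_{n ≥ 0} K S_n`: the vector space whose basis is the disjoint union of the `S_n`. -/
abbrev KS (K : Type u) [Field K] : Type u := AllPerm →₀ K

/-- The `i`-th letter `iπ ∈ {1, …, n}` of the image line of `π ∈ S_n`, for `1 ≤ i ≤ n`
(and `0` for all other `i`). -/
def letter {n : ℕ} (π : Equiv.Perm (Fin n)) (i : ℕ) : ℕ :=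
  if h : 1 ≤ i ∧ i ≤ n then (π ⟨i - 1, by omega⟩ : ℕ) + 1 else 0

/-- The descent set `{i | 1 ≤ i ≤ n - 1, iπ > (i+1)π}`. -/
def Des {n : ℕ} (π : Equiv.Perm (Fin n)) : Finset ℕ :=
  (Finset.Icc 1 (n - 1)).filter fun i => letter π i > letter π (i + 1)

/-- The peak set `{i | 2 ≤ i ≤ n - 1, (i-1)π < iπ > (i+1)π}`. -/
def Peak {n : ℕ} (π : Equiv.Perm (Fin n)) : Finset ℕ :=
  (Finset.Icc 2 (n - 1)).filter fun i =>
    letter π (i - 1) < letter π i ∧ letter π i > letter π (i + 1)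

/-- The image line of `w` is a concatenation `u v` of two words of lengths `n` and `m` such that
`u` has the same relative order as the image line of `σ ∈ S_n`, and `v` has the same relative order
as that of `τ ∈ S_m`; that is, `σ` and `τ` are the standardizations of `u` and `v`. -/
def IsSplit {N n m : ℕ} (w : Equiv.Perm (Fin N)) (σ : Equiv.Perm (Fin n))
    (τ : Equiv.Perm (Fin m)) : Prop :=
  N = n + m ∧
  (∀ i ∈ Finset.Icc 1 n, ∀ j ∈ Finset.Icc 1 n,
    (letter w i < letter w j ↔ letter σ i < letter σ j)) ∧
  (∀ i ∈ Finset.Icc 1 m, ∀ j ∈ Finset.Icc 1 m,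
    (letter w (n + i) < letter w (n + j) ↔ letter τ i < letter τ j))

instance {N n m : ℕ} (w : Equiv.Perm (Fin N)) (σ : Equiv.Perm (Fin n))
    (τ : Equiv.Perm (Fin m)) : Decidable (IsSplit w σ τ) := by
  unfold IsSplit; infer_instance

noncomputable section

variable (K : Type u) [Field K]

/-- A permutation, regarded as an element of `KS`. -/
def perm {n : ℕ} (π : Equiv.Perm (Fin n)) : KS K := Finsupp.single ⟨n, π⟩ 1

/-- The empty permutation `∅ ∈ S_0`. -/
def emptyPerm : KS K := perm K (1 : Equiv.Perm (Fin 0))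

/-- The convolution (outer) product of two permutations `σ ∈ S_n`, `τ ∈ S_m`: the sum of all
`w ∈ S_{n+m}` whose image line is `u v`, where `u` standardizes to `σ` and `v` to `τ`. -/
def starPerm (σ τ : AllPerm) : KS K :=
  ∑ w : Equiv.Perm (Fin (σ.1 + τ.1)), if IsSplit w σ.2 τ.2 then perm K w else 0

/-- The outer product `⋆` on `KS`, by bilinear extension. -/
def outerMul : KS K →ₗ[K] KS K →ₗ[K] KS K :=
  Finsupp.lift (KS K →ₗ[K] KS K) K AllPerm fun σ =>
    Finsupp.lift (KS K) K AllPerm fun τ => starPerm K σ τ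

/-- The coproduct of a permutation `π ∈ S_n`: the sum over all `k + l = n` of `α ⊗ β`, where `α` is
the subword of the image line of `π` on the letters `1, …, k` and `β` is the standardization of the
subword on the letters `k + 1, …, n`. Since `α⁻¹` and `β⁻¹` record the relative positions of these
letters in `π`, this says that `α⁻¹` and `β⁻¹` are the standardizations of the first `k` and the
last `l` letters of the image line of `π⁻¹`. -/
def coprodPerm (π : AllPerm) : KS K ⊗[K] KS K :=
  ∑ p ∈ Finset.HasAntidiagonal.antidiagonal π.1, ∑ α : Equiv.Perm (Fin p.1), ∑ β : Equiv.Perm (Fin p.2),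
    if IsSplit π.2⁻¹ α⁻¹ β⁻¹ then perm K α ⊗ₜ[K] perm K β else 0

/-- The coproduct `↓` on `KS`, by linear extension. -/
def coprod : KS K →ₗ[K] KS K ⊗[K] KS K :=
  Finsupp.lift (KS K ⊗[K] KS K) K AllPerm fun π => coprodPerm K π

/-- The counit of `KS`: the coefficient of the empty permutation. -/
def counit : KS K →ₗ[K] K := Finsupp.lapply ⟨0, 1⟩

/-- `Δ^D`: the sum of all `π ∈ S_n` with descent set `D`. -/
def descentSum (n : ℕ) (D : Finset ℕ) : KS K :=
  ∑ π : Equiv.Perm (Fin n), if Des π = D then perm K π else 0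

/-- `Π^P`: the sum of all `π ∈ S_n` with peak set `P`. -/
def peakSum (n : ℕ) (P : Finset ℕ) : KS K :=
  ∑ π : Equiv.Perm (Fin n), if Peak π = P then perm K π else 0

/-- `𝒟_n`: the linear span of the `Δ^D`, `D ⊆ {1, …, n-1}`. -/
def descentSpace (n : ℕ) : Submodule K (KS K) :=
  Submodule.span K {x | ∃ D ⊆ Finset.Icc 1 (n - 1), x = descentSum K n D}

/-- `𝒫_n`: the linear span of the `Π^P`, `P ⊆ {2, …, n-1}`. -/
def peakSpace (n : ℕ) : Submodule K (KS K) :=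
  Submodule.span K {x | ∃ P ⊆ Finset.Icc 2 (n - 1), x = peakSum K n P}

/-- `𝒟 = ⊕_n 𝒟_n` (the sum is direct, since `𝒟_n ⊆ K S_n`). -/
def descentAlg : Submodule K (KS K) := ⨆ n, descentSpace K n

/-- `𝒫 = ⊕_n 𝒫_n` (the sum is direct, since `𝒫_n ⊆ K S_n`). -/
def peakAlg : Submodule K (KS K) := ⨆ n, peakSpace K n

/-- `Ξ̃^n = 2 Π^∅ ∈ 𝒫_n` for `n ≥ 1`, and `Ξ̃^0 = ∅`. -/
def xiTilde (n : ℕ) : KS K :=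
  if n = 0 then emptyPerm K else (2 : K) • peakSum K n ∅

/-- `Ξ̃^q = Ξ̃^{q_1} ⋆ ⋯ ⋆ Ξ̃^{q_k}` for a word `q = q_1. ⋯ .q_k` over the positive integers; it is `∅`
for the empty word. -/
def xiTildeWord (q : List ℕ+) : KS K :=
  q.foldr (fun a x => outerMul K (xiTilde K a) x) (emptyPerm K)

variable {K}

/-- The injective linear map `e : H → KS` identifies the Hopf algebra `H` with the subspace `U` of
`KS`, endowed with the unit `∅`, the product `⋆`, the coproduct `↓` and the counit of `KS`. So `U`
is closed under these operations, and they make `U` a Hopf algebra. -/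
structure IdentifiesHopf {H : Type u} [Ring H] [HopfAlgebra K H] (e : H →ₗ[K] KS K)
    (U : Submodule K (KS K)) : Prop where
  injective : Function.Injective e
  range_eq : LinearMap.range e = U
  map_one : e 1 = emptyPerm K
  map_mul : ∀ x y : H, e (x * y) = outerMul K (e x) (e y)
  map_comul : ∀ x : H, TensorProduct.map e e (Coalgebra.comul (R := K) x) = coprod K (e x)
  map_counit : ∀ x : H, Coalgebra.counit (R := K) x = counit K (e x)

/-- A subalgebra `A` of a Hopf algebra `H` is a Hopf subalgebra if the coproduct maps `A` into
`A ⊗ A` and the antipode maps `A` into `A`. -/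
structure IsHopfSubalgebra {H : Type u} [Ring H] [HopfAlgebra K H] (A : Subalgebra K H) :
    Prop where
  comul_mem : ∀ x ∈ A, Coalgebra.comul (R := K) x ∈
    LinearMap.range (TensorProduct.map A.val.toLinearMap A.val.toLinearMap)
  antipode_mem : ∀ x ∈ A, HopfAlgebra.antipode K x ∈ A

end

end PeakHopf

namespace PeakHopf

open Finset.HasAntidiagonal (antidiagonal)

/-! The proof moves the statement to the free algebra `NSym` on generators H_1, H_2, …, with H_0 = 1
and coproduct H_n ↦ Σ H_k ⊗ H_{n-k}, whose Hopf structure can be checked without permutations. The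
map `nsymToKS` sends H_n to the increasing permutation of degree n and turns products into ⋆. It is
injective by lexicographic triangularity (`exists_leading_perm`), and its image is 𝒟 because the
increasing permutations generate all Δ^D (`statSum_Des_mem_adjoin`). It respects coproducts
(`coprod_nsymToKS`): a product of H's becomes the sum of the inverse standardizations of all words
of a given content, and ↓ cuts these words in two.

Put σ(t) = Σ H_n t^n and Ξ(t) = σ(-t)⁻¹ σ(t) (`peakSeries`). In KS the coefficients of σ(-t)⁻¹
become the decreasing permutations. The products "decreasing ⋆ increasing" of total degree n ≥ 1
together hit each permutation without peaks exactly twice, so the coefficients of Ξ(t) become the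
Ξ̃^n (`nsymToKS_coeff_peakSeries`). As σ is group-like, so is Ξ, which is the coproduct formula.
Moreover Ξ(t) Ξ(-t) = 1, so the even coefficients are polynomials in the odd ones
(`coeff_peakSeries_mem`). Since the sums Π^∅ generate 𝒫 (`statSum_Peak_mem_adjoin`), the odd Ξ̃^n
generate 𝒫.

There are no relations among the odd ones (`oddHom_injective`). Over the free algebra on the odd
numbers there is a series y with y(t) y(-t) = 1 and prescribed odd coefficients. The homomorphism
sending σ to (1 + y)/2 sends Ξ to y, and this gives a left inverse of the map from the free algebra.
Freeness, and with it the basis of words, follows. -/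

/-! ### Standardization and segments of image lines. -/

theorem letter_fin {n : ℕ} (π : Equiv.Perm (Fin n)) (i : Fin n) : letter π (i + 1) = π i + 1 := by
  have h : 1 ≤ (i : ℕ) + 1 ∧ (i : ℕ) + 1 ≤ n := by omega
  simp [letter, h]

theorem letter_eq {n : ℕ} (π : Equiv.Perm (Fin n)) {i : ℕ} (h1 : 1 ≤ i) (h2 : i ≤ n) :
    letter π i = π ⟨i - 1, by omega⟩ + 1 := by
  simp [letter, h1, h2]

/-- The permutation with the same relative order as `f`, ties being broken from left to right. -/
def stdPerm {α : Type*} [LinearOrder α] {n : ℕ} (f : Fin n → α) : Equiv.Perm (Fin n) :=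
  (Tuple.sort f)⁻¹

theorem stdPerm_lt_iff {α : Type*} [LinearOrder α] {n : ℕ} (f : Fin n → α) (i j : Fin n) :
    stdPerm f i < stdPerm f j ↔ f i < f j ∨ f i = f j ∧ i < j := by
  have h := (Tuple.eq_sort_iff' (f := f) (σ := Tuple.sort f)).1 rfl
  have := h.lt_iff_lt (a := stdPerm f i) (b := stdPerm f j)
  rw [← this]
  have h2 (k : Fin n) : Tuple.sort f (stdPerm f k) = k := (Tuple.sort f).apply_symm_apply k
  simp only [Equiv.trans_apply, h2]
  exact Prod.Lex.toLex_lt_toLex (x := (f i, i)) (y := (f j, j))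

theorem stdPerm_lt_iff_of_injective {α : Type*} [LinearOrder α] {n : ℕ} {f : Fin n → α}
    (hf : Function.Injective f) (i j : Fin n) : stdPerm f i < stdPerm f j ↔ f i < f j := by
  rw [stdPerm_lt_iff]
  constructor
  · rintro (h | ⟨h, h'⟩)
    · exact h
    · exact absurd (hf h) h'.ne
  · exact Or.inl

/-- The permutation σ⁻¹ followed by τ is an order automorphism of a finite chain, hence the
identity. -/
theorem perm_eq_of_lt_iff {n : ℕ} {σ τ : Equiv.Perm (Fin n)}
    (h : ∀ i j, σ i < σ j ↔ τ i < τ j) : σ = τ := by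
  have hm : StrictMono (σ.symm.trans τ) := fun i j hij => by
    have := (h (σ.symm i) (σ.symm j)).1 (by simpa using hij)
    simpa using this
  have h1 := Subsingleton.elim (hm.orderIsoOfSurjective _ (Equiv.surjective _)) (OrderIso.refl _)
  ext1 x
  have h2 := DFunLike.congr_fun h1 (σ x)
  have h3 : τ (σ.symm (σ x)) = σ x := h2
  simpa using h3.symm

theorem perm_eq_of_letter_lt_iff {n : ℕ} {σ τ : Equiv.Perm (Fin n)}
    (h : ∀ i ∈ Finset.Icc 1 n, ∀ j ∈ Finset.Icc 1 n,
      (letter σ i < letter σ j ↔ letter τ i < letter τ j)) : σ = τ := by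
  refine perm_eq_of_lt_iff fun i j => ?_
  have := h (i + 1) (by simp) (j + 1) (by simp)
  simp only [letter_fin] at this
  simpa using this

theorem letter_inj {n : ℕ} (w : Equiv.Perm (Fin n)) {i j : ℕ} (hi : 1 ≤ i) (hi' : i ≤ n)
    (hj : 1 ≤ j) (hj' : j ≤ n) (h : letter w i = letter w j) : i = j := by
  rw [letter_eq w hi hi', letter_eq w hj hj'] at h
  have h2 := w.injective (Fin.ext (Nat.succ_injective h))
  have h3 := Fin.mk.inj h2
  omega

/-- The standardization of the letters of `w` at the positions `a + 1, …, a + n`. -/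
def seg {N : ℕ} (w : Equiv.Perm (Fin N)) (a n : ℕ) : Equiv.Perm (Fin n) :=
  stdPerm fun i : Fin n => letter w (a + (i + 1))

theorem letter_seg_lt_iff {N : ℕ} (w : Equiv.Perm (Fin N)) {a n : ℕ} (h : a + n ≤ N) {i j : ℕ}
    (hi : 1 ≤ i) (hi' : i ≤ n) (hj : 1 ≤ j) (hj' : j ≤ n) :
    letter (seg w a n) i < letter (seg w a n) j ↔ letter w (a + i) < letter w (a + j) := by
  obtain ⟨i, rfl⟩ := Nat.exists_eq_add_of_le' hi
  obtain ⟨j, rfl⟩ := Nat.exists_eq_add_of_le' hj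
  have h1 := letter_fin (seg w a n) ⟨i, hi'⟩
  have h2 := letter_fin (seg w a n) ⟨j, hj'⟩
  simp only at h1 h2
  rw [h1, h2, Nat.succ_lt_succ_iff, Fin.val_fin_lt, seg, stdPerm_lt_iff_of_injective]
  intro x y hxy
  have := letter_inj w (by omega) (by omega) (by omega) (by omega) hxy
  omega

/-- A permutation is determined by the relative order of its letters, so `w` leaves no choice for
the two factors. This turns ⋆ into a product of coefficient functions, as in `outerMul_ofCoeff`. -/
theorem isSplit_iff {n m : ℕ} (w : Equiv.Perm (Fin (n + m))) (σ : Equiv.Perm (Fin n))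
    (τ : Equiv.Perm (Fin m)) : IsSplit w σ τ ↔ σ = seg w 0 n ∧ τ = seg w n m := by
  constructor
  · rintro ⟨-, h1, h2⟩
    constructor
    · refine perm_eq_of_letter_lt_iff fun i hi j hj => ?_
      have hi' := Finset.mem_Icc.1 hi
      have hj' := Finset.mem_Icc.1 hj
      rw [← h1 i hi j hj, letter_seg_lt_iff w (by omega) hi'.1 hi'.2 hj'.1 hj'.2]
      simp
    · refine perm_eq_of_letter_lt_iff fun i hi j hj => ?_
      have hi' := Finset.mem_Icc.1 hi
      have hj' := Finset.mem_Icc.1 hj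
      rw [← h2 i hi j hj, letter_seg_lt_iff w (by omega) hi'.1 hi'.2 hj'.1 hj'.2]
  · rintro ⟨rfl, rfl⟩
    refine ⟨rfl, fun i hi j hj => ?_, fun i hi j hj => ?_⟩
    · have hi' := Finset.mem_Icc.1 hi
      have hj' := Finset.mem_Icc.1 hj
      rw [letter_seg_lt_iff w (by omega) hi'.1 hi'.2 hj'.1 hj'.2]
      simp
    · have hi' := Finset.mem_Icc.1 hi
      have hj' := Finset.mem_Icc.1 hj
      rw [letter_seg_lt_iff w (by omega) hi'.1 hi'.2 hj'.1 hj'.2]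

theorem seg_seg {N : ℕ} (w : Equiv.Perm (Fin N)) {a n b m : ℕ} (h : a + n ≤ N) (h' : b + m ≤ n) :
    seg (seg w a n) b m = seg w (a + b) m := by
  refine perm_eq_of_letter_lt_iff fun i hi j hj => ?_
  have hi' := Finset.mem_Icc.1 hi
  have hj' := Finset.mem_Icc.1 hj
  rw [letter_seg_lt_iff _ h' hi'.1 hi'.2 hj'.1 hj'.2,
    letter_seg_lt_iff _ h (by omega) (by omega) (by omega) (by omega),
    letter_seg_lt_iff w (by omega) hi'.1 hi'.2 hj'.1 hj'.2, Nat.add_assoc, Nat.add_assoc]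

theorem seg_self {N : ℕ} (w : Equiv.Perm (Fin N)) : seg w 0 N = w := by
  refine perm_eq_of_letter_lt_iff fun i hi j hj => ?_
  have hi' := Finset.mem_Icc.1 hi
  have hj' := Finset.mem_Icc.1 hj
  rw [letter_seg_lt_iff _ (by omega) hi'.1 hi'.2 hj'.1 hj'.2]
  simp

/-! ### The outer product in coordinates, and the algebra it defines. -/

noncomputable section

variable (K : Type u) [Field K]

/-- The element of `K S_n` with given coefficients. -/
def ofCoeff (n : ℕ) (f : Equiv.Perm (Fin n) → K) : KS K := ∑ π, f π • perm K π

variable {K}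

theorem ofCoeff_apply (n : ℕ) (f : Equiv.Perm (Fin n) → K) (w : Equiv.Perm (Fin n)) :
    ofCoeff K n f ⟨n, w⟩ = f w := by
  classical
  simp [ofCoeff, perm, Finsupp.single_apply]

theorem ofCoeff_apply_of_ne {n N : ℕ} (f : Equiv.Perm (Fin n) → K) (w : Equiv.Perm (Fin N))
    (h : n ≠ N) : ofCoeff K n f ⟨N, w⟩ = 0 := by
  classical
  simp [ofCoeff, perm, h]

theorem ofCoeff_add (n : ℕ) (f g : Equiv.Perm (Fin n) → K) :
    ofCoeff K n (fun w => f w + g w) = ofCoeff K n f + ofCoeff K n g := by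
  simp [ofCoeff, add_smul, Finset.sum_add_distrib]

theorem ofCoeff_smul (n : ℕ) (c : K) (f : Equiv.Perm (Fin n) → K) :
    ofCoeff K n (fun w => c * f w) = c • ofCoeff K n f := by
  simp [ofCoeff, mul_smul, Finset.smul_sum]

theorem ofCoeff_sum {ι : Type*} (n : ℕ) (s : Finset ι) (f : ι → Equiv.Perm (Fin n) → K) :
    ofCoeff K n (fun w => ∑ i ∈ s, f i w) = ∑ i ∈ s, ofCoeff K n (f i) := by
  simp only [ofCoeff, Finset.sum_smul]
  exact Finset.sum_comm

theorem perm_eq_ofCoeff {n : ℕ} (σ : Equiv.Perm (Fin n)) :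
    perm K σ = ofCoeff K n fun w => if w = σ then 1 else 0 := by
  simp [ofCoeff]

theorem outerMul_perm {n m : ℕ} (σ : Equiv.Perm (Fin n)) (τ : Equiv.Perm (Fin m)) :
    outerMul K (perm K σ) (perm K τ) =
      ofCoeff K (n + m) fun w => if σ = seg w 0 n ∧ τ = seg w n m then 1 else 0 := by
  simp [outerMul, perm, starPerm, ofCoeff, isSplit_iff]

theorem outerMul_ofCoeff (n m : ℕ) (f : Equiv.Perm (Fin n) → K) (g : Equiv.Perm (Fin m) → K) :
    outerMul K (ofCoeff K n f) (ofCoeff K m g) =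
      ofCoeff K (n + m) fun w => f (seg w 0 n) * g (seg w n m) := by
  rw [ofCoeff, ofCoeff]
  simp only [map_sum, LinearMap.sum_apply, map_smul, LinearMap.smul_apply, outerMul_perm]
  simp only [← ofCoeff_smul, ← ofCoeff_sum]
  congr 1
  ext w
  rw [Finset.sum_eq_single (seg w n m) (fun b _ hb => by simp [hb]) (by simp),
    Finset.sum_eq_single (seg w 0 n) (fun b _ hb => by simp [hb]) (by simp)]
  simp [mul_comm]

/-- Reduces multilinear identities to homogeneous elements, on which ⋆ has the closed formula
`outerMul_ofCoeff`. -/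
theorem KS_induction {p : KS K → Prop} (hadd : ∀ x y, p x → p y → p (x + y))
    (hcoeff : ∀ n f, p (ofCoeff K n f)) (x : KS K) : p x := by
  induction x using Finsupp.induction_linear with
  | zero => simpa [ofCoeff] using hcoeff 0 (fun _ => 0)
  | add x y hx hy => exact hadd x y hx hy
  | single a c =>
    obtain ⟨n, σ⟩ := a
    have h := hcoeff n (fun w => c * if w = σ then 1 else 0)
    rw [ofCoeff_smul, ← perm_eq_ofCoeff, perm] at h
    simpa using h

theorem outerMul_assoc (x y z : KS K) :
    outerMul K (outerMul K x y) z = outerMul K x (outerMul K y z) := by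
  induction x using KS_induction with
  | hadd x x' hx hx' => simp [hx, hx']
  | hcoeff n f =>
  induction y using KS_induction with
  | hadd x x' hx hx' => simp [hx, hx']
  | hcoeff m g =>
  induction z using KS_induction with
  | hadd x x' hx hx' => simp [hx, hx']
  | hcoeff l h =>
  -- The two bracketings live in the degrees n + m + l and n + (m + l). A coefficient function
  -- defined for every degree N lets the degree be rewritten afterwards.
  let F (N : ℕ) (w : Equiv.Perm (Fin N)) : K :=
    f (seg w 0 n) * g (seg w n m) * h (seg w (n + m) l)
  have h1 : outerMul K (outerMul K (ofCoeff K n f) (ofCoeff K m g)) (ofCoeff K l h) =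
      ofCoeff K (n + m + l) (F _) := by
    rw [outerMul_ofCoeff, outerMul_ofCoeff]
    congr 1
    ext w
    rw [seg_seg w (by omega) (by omega), seg_seg w (by omega) (by omega)]
    simp [F]
  have h2 : outerMul K (ofCoeff K n f) (outerMul K (ofCoeff K m g) (ofCoeff K l h)) =
      ofCoeff K (n + (m + l)) (F _) := by
    rw [outerMul_ofCoeff, outerMul_ofCoeff]
    congr 1
    ext w
    rw [seg_seg w (by omega) (by omega), seg_seg w (by omega) (by omega)]
    simp [F, mul_assoc]
  rw [h1, h2, Nat.add_assoc]

theorem emptyPerm_eq : emptyPerm K = ofCoeff K 0 fun _ => 1 := by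
  simp [emptyPerm, ofCoeff]

theorem emptyPerm_outerMul (x : KS K) : outerMul K (emptyPerm K) x = x := by
  induction x using KS_induction with
  | hadd x x' hx hx' => simp [hx, hx']
  | hcoeff m g =>
  let F (N : ℕ) (w : Equiv.Perm (Fin N)) : K := g (seg w 0 m)
  have h1 : outerMul K (emptyPerm K) (ofCoeff K m g) = ofCoeff K (0 + m) (F _) := by
    rw [emptyPerm_eq, outerMul_ofCoeff]
    simp [F]
  rw [h1, Nat.zero_add]
  simp [F, seg_self]

theorem outerMul_emptyPerm (x : KS K) : outerMul K x (emptyPerm K) = x := by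
  induction x using KS_induction with
  | hadd x x' hx hx' => simp [hx, hx']
  | hcoeff m g =>
  rw [emptyPerm_eq, outerMul_ofCoeff]
  simp [seg_self]

variable (K)

/-- The space `KS`, as a type carrying the outer product as its multiplication. -/
def MR : Type u := KS K

instance : AddCommGroup (MR K) := inferInstanceAs (AddCommGroup (KS K))

instance : Module K (MR K) := inferInstanceAs (Module K (KS K))

/-- The identification of the algebra `MR K` with the space `KS K`. -/
def toKS : MR K ≃ₗ[K] KS K := LinearEquiv.refl K (KS K)

instance : Ring (MR K) :=
  { (inferInstance : AddCommGroup (MR K)) with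
    mul := fun x y => (toKS K).symm (outerMul K (toKS K x) (toKS K y))
    one := (toKS K).symm (emptyPerm K)
    mul_assoc := outerMul_assoc (K := K)
    one_mul := emptyPerm_outerMul (K := K)
    mul_one := outerMul_emptyPerm (K := K)
    left_distrib := fun x y z => map_add (outerMul K x) y z
    right_distrib := fun x y z => LinearMap.map_add₂ (outerMul K) x y z
    zero_mul := fun x => LinearMap.map_zero₂ (outerMul K) x
    mul_zero := fun x => map_zero (outerMul K x) }

instance : Algebra K (MR K) :=
  Algebra.ofModule (fun r x y => LinearMap.map_smul₂ (outerMul K) r x y)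
    (fun r x y => map_smul (outerMul K x) r y)

variable {K}

theorem toKS_mul (x y : MR K) : toKS K (x * y) = outerMul K (toKS K x) (toKS K y) := rfl

theorem toKS_one : toKS K 1 = emptyPerm K := rfl

variable (K)

/-- The element of `K S_n` with given coefficients, in the algebra `MR K`. -/
def mrOf (n : ℕ) (f : Equiv.Perm (Fin n) → K) : MR K := (toKS K).symm (ofCoeff K n f)

variable {K}

theorem toKS_mrOf (n : ℕ) (f : Equiv.Perm (Fin n) → K) : toKS K (mrOf K n f) = ofCoeff K n f := rfl

theorem mrOf_mul (n m : ℕ) (f : Equiv.Perm (Fin n) → K) (g : Equiv.Perm (Fin m) → K) :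
    mrOf K n f * mrOf K m g = mrOf K (n + m) fun w => f (seg w 0 n) * g (seg w n m) :=
  outerMul_ofCoeff n m f g

end

/-! ### Descent and peak sets as statistics compatible with segments. -/

theorem mem_Des {n : ℕ} (π : Equiv.Perm (Fin n)) (i : ℕ) :
    i ∈ Des π ↔ 1 ≤ i ∧ i + 1 ≤ n ∧ letter π (i + 1) < letter π i := by
  simp only [Des, Finset.mem_filter, Finset.mem_Icc]
  constructor
  · rintro ⟨⟨h1, h2⟩, h3⟩
    exact ⟨h1, by omega, h3⟩
  · rintro ⟨h1, h2, h3⟩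
    exact ⟨⟨h1, by omega⟩, h3⟩

theorem mem_Des_seg {N : ℕ} (w : Equiv.Perm (Fin N)) {a n : ℕ} (h : a + n ≤ N) (i : ℕ) :
    i ∈ Des (seg w a n) ↔ 1 ≤ i ∧ i + 1 ≤ n ∧ a + i ∈ Des w := by
  rw [mem_Des, mem_Des]
  constructor
  · rintro ⟨h1, h2, h3⟩
    rw [letter_seg_lt_iff w h (by omega) h2 h1 (by omega)] at h3
    exact ⟨h1, h2, by omega, by omega, h3⟩
  · rintro ⟨h1, h2, -, -, h3⟩
    refine ⟨h1, h2, ?_⟩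
    rwa [letter_seg_lt_iff w h (by omega) h2 h1 (by omega)]

/-- Neighbouring letters differ, so an ascent is the same as a non-descent; hence the peak set
depends on the descent set only. -/
theorem mem_Peak {n : ℕ} (π : Equiv.Perm (Fin n)) (i : ℕ) :
    i ∈ Peak π ↔ 2 ≤ i ∧ i ∈ Des π ∧ i - 1 ∉ Des π := by
  simp only [mem_Des, Peak, Finset.mem_filter, Finset.mem_Icc]
  by_cases h2 : 2 ≤ i
  · by_cases h3 : i + 1 ≤ n
    · have h4 : letter π (i - 1) ≠ letter π i := fun h => by
        have := letter_inj π (by omega) (by omega) (by omega) (by omega) h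
        omega
      have h5 : i - 1 + 1 = i := by omega
      rw [h5]
      omega
    · omega
  · omega

theorem mem_Peak_seg {N : ℕ} (w : Equiv.Perm (Fin N)) {a n : ℕ} (h : a + n ≤ N) (i : ℕ) :
    i ∈ Peak (seg w a n) ↔ 2 ≤ i ∧ i + 1 ≤ n ∧ a + i ∈ Peak w := by
  simp only [mem_Peak, mem_Des_seg w h]
  by_cases h2 : 2 ≤ i
  · have : a + (i - 1) = a + i - 1 := by omega
    rw [this]
    constructor
    · rintro ⟨-, ⟨h1, h3, h4⟩, h5⟩
      exact ⟨h2, h3, by omega, h4, fun h6 => h5 ⟨by omega, by omega, h6⟩⟩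
    · rintro ⟨-, h3, -, h4, h5⟩
      exact ⟨h2, ⟨by omega, h3, h4⟩, fun h6 => h5 h6.2.2⟩
  · omega

/-- A statistic on permutations with values in subsets of `{b, …, n - 1}` that is compatible with
passing to segments of the image line. -/
structure IsLocalStat (b : ℕ) (s : ∀ {n : ℕ}, Equiv.Perm (Fin n) → Finset ℕ) : Prop where
  mem_seg : ∀ {N : ℕ} (w : Equiv.Perm (Fin N)) {a n : ℕ}, a + n ≤ N → ∀ i,
    i ∈ s (seg w a n) ↔ b ≤ i ∧ i + 1 ≤ n ∧ a + i ∈ s w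

theorem isLocalStat_Des : IsLocalStat 1 Des := ⟨mem_Des_seg⟩

theorem isLocalStat_Peak : IsLocalStat 2 Peak := ⟨mem_Peak_seg⟩

/-- The part of `S` strictly between `a` and `a + n` (and at least `a + b`), shifted by `a`. -/
def restr (b a n : ℕ) (S : Finset ℕ) : Finset ℕ := (Finset.Icc b (n - 1)).filter fun i =>
  i + 1 ≤ n ∧ a + i ∈ S

theorem mem_restr {b a n : ℕ} {S : Finset ℕ} {i : ℕ} :
    i ∈ restr b a n S ↔ b ≤ i ∧ i + 1 ≤ n ∧ a + i ∈ S := by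
  simp only [restr, Finset.mem_filter, Finset.mem_Icc]
  exact ⟨fun h => ⟨h.1.1, h.2⟩, fun h => ⟨⟨h.1, by have := h.2.1; omega⟩, h.2⟩⟩

namespace IsLocalStat

variable {b : ℕ} {s : ∀ {n : ℕ}, Equiv.Perm (Fin n) → Finset ℕ} (hs : IsLocalStat b s)
include hs

theorem seg_eq {N : ℕ} (w : Equiv.Perm (Fin N)) {a n : ℕ} (h : a + n ≤ N) :
    s (seg w a n) = restr b a n (s w) := by
  ext i
  rw [hs.mem_seg w h, mem_restr]

theorem mem_bounds {n : ℕ} (w : Equiv.Perm (Fin n)) {i : ℕ} (h : i ∈ s w) : b ≤ i ∧ i + 1 ≤ n := by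
  rw [← seg_self w, hs.mem_seg w (by omega)] at h
  exact ⟨h.1, h.2.1⟩

theorem subset_Icc {n : ℕ} (w : Equiv.Perm (Fin n)) : s w ⊆ Finset.Icc b (n - 1) := fun i h => by
  have := hs.mem_bounds w h
  rw [Finset.mem_Icc]
  omega

end IsLocalStat

/-! ### Fibre sums of a local statistic: closure under ⋆ and generators. -/

noncomputable section

variable (K : Type u) [Field K]

/-- The sum of all permutations in `S_n` on which the statistic `s` takes the value `P`. -/
def statSum (s : ∀ {n : ℕ}, Equiv.Perm (Fin n) → Finset ℕ) (n : ℕ) (P : Finset ℕ) : MR K :=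
  mrOf K n fun w => if s w = P then 1 else 0

/-- The span of all sums over the fibres of `s`. -/
def statSpace (b : ℕ) (s : ∀ {n : ℕ}, Equiv.Perm (Fin n) → Finset ℕ) : Submodule K (MR K) :=
  ⨆ n, Submodule.span K {x | ∃ D ⊆ Finset.Icc b (n - 1), x = statSum K s n D}

theorem toKS_statSum_Des (n : ℕ) (D : Finset ℕ) : toKS K (statSum K Des n D) = descentSum K n D := by
  simp [statSum, toKS_mrOf, ofCoeff, descentSum]

theorem toKS_statSum_Peak (n : ℕ) (D : Finset ℕ) :
    toKS K (statSum K Peak n D) = peakSum K n D := by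
  simp [statSum, toKS_mrOf, ofCoeff, peakSum]

theorem map_statSpace_Des :
    (statSpace K 1 Des).map (toKS K).toLinearMap = descentAlg K := by
  rw [statSpace, descentAlg, Submodule.map_iSup]
  congr 1
  ext1 n
  rw [Submodule.map_span, descentSpace]
  congr 1
  ext x
  constructor
  · rintro ⟨_, ⟨D, hD, rfl⟩, rfl⟩
    exact ⟨D, hD, toKS_statSum_Des K n D⟩
  · rintro ⟨D, hD, rfl⟩
    exact ⟨_, ⟨D, hD, rfl⟩, toKS_statSum_Des K n D⟩

theorem map_statSpace_Peak :
    (statSpace K 2 Peak).map (toKS K).toLinearMap = peakAlg K := by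
  rw [statSpace, peakAlg, Submodule.map_iSup]
  congr 1
  ext1 n
  rw [Submodule.map_span, peakSpace]
  congr 1
  ext x
  constructor
  · rintro ⟨_, ⟨D, hD, rfl⟩, rfl⟩
    exact ⟨D, hD, toKS_statSum_Peak K n D⟩
  · rintro ⟨D, hD, rfl⟩
    exact ⟨_, ⟨D, hD, rfl⟩, toKS_statSum_Peak K n D⟩

variable {K}

theorem mrOf_add (n : ℕ) (f g : Equiv.Perm (Fin n) → K) :
    mrOf K n (fun w => f w + g w) = mrOf K n f + mrOf K n g := ofCoeff_add n f g

theorem mrOf_smul (n : ℕ) (c : K) (f : Equiv.Perm (Fin n) → K) :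
    mrOf K n (fun w => c * f w) = c • mrOf K n f := ofCoeff_smul n c f

theorem mrOf_sum {ι : Type*} (n : ℕ) (t : Finset ι) (f : ι → Equiv.Perm (Fin n) → K) :
    mrOf K n (fun w => ∑ i ∈ t, f i w) = ∑ i ∈ t, mrOf K n (f i) := ofCoeff_sum n t f

theorem mrOf_zero (n : ℕ) : mrOf K n (fun _ => (0 : K)) = 0 := by
  simpa using mrOf_smul n (0 : K) (fun _ => 0)

theorem mrOf_one : mrOf K 0 (fun _ => 1) = 1 := (emptyPerm_eq (K := K)).symm

section

variable {b : ℕ} {s : ∀ {n : ℕ}, Equiv.Perm (Fin n) → Finset ℕ} (hs : IsLocalStat b s)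
include hs

theorem statSum_eq_zero {n : ℕ} {P : Finset ℕ} (h : ¬ P ⊆ Finset.Icc b (n - 1)) :
    statSum K s n P = 0 := by
  rw [statSum, ← mrOf_zero n]
  congr 1
  ext w
  rw [if_neg]
  rintro rfl
  exact h (hs.subset_Icc w)

/-- An element whose coefficients depend only on the value of `s` is a combination of the fibre
sums; the finitely many possible values lie in the powerset used here. -/
theorem mrOf_stat_mem (n : ℕ) (F : Finset ℕ → K) :
    mrOf K n (fun w => F (s w)) ∈ statSpace K b s := by
  have h : mrOf K n (fun w => F (s w)) =
      ∑ P ∈ (Finset.Icc b (n - 1)).powerset, F P • statSum K s n P := by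
    simp only [statSum, ← mrOf_smul, ← mrOf_sum]
    congr 1
    ext w
    rw [Finset.sum_eq_single (s w)]
    · simp
    · intro P _ h
      simp [h.symm]
    · intro h
      exact absurd (Finset.mem_powerset.2 (hs.subset_Icc w)) h
  rw [h]
  refine Submodule.sum_mem _ fun P hP => Submodule.smul_mem _ _ ?_
  exact Submodule.mem_iSup_of_mem n
    (Submodule.subset_span ⟨P, Finset.mem_powerset.1 hP, rfl⟩)

/-- By locality the coefficient at `w` is a function of `s w` alone, so `mrOf_stat_mem` applies to
the product. -/
theorem statSum_mul_statSum (n m : ℕ) (P Q : Finset ℕ) :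
    statSum K s n P * statSum K s m Q = mrOf K (n + m) fun w =>
      if restr b 0 n (s w) = P ∧ restr b n m (s w) = Q then 1 else 0 := by
  rw [statSum, statSum, mrOf_mul]
  congr 1
  ext w
  rw [hs.seg_eq w (by omega), hs.seg_eq w (by omega), ite_and]
  split_ifs <;> simp

theorem statSum_mem (n : ℕ) (P : Finset ℕ) : statSum K s n P ∈ statSpace K b s :=
  mrOf_stat_mem hs n fun S => if S = P then 1 else 0

theorem mul_mem_statSpace {x y : MR K} (hx : x ∈ statSpace K b s) (hy : y ∈ statSpace K b s) :
    x * y ∈ statSpace K b s := by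
  rw [statSpace, ← Submodule.span_iUnion] at hx hy
  induction hx, hy using Submodule.span_induction₂ with
  | mem_mem x y hx hy =>
    obtain ⟨n, P, -, rfl⟩ := Set.mem_iUnion.1 hx
    obtain ⟨m, Q, -, rfl⟩ := Set.mem_iUnion.1 hy
    rw [statSum_mul_statSum hs]
    exact mrOf_stat_mem hs _ fun S => if restr b 0 n S = P ∧ restr b n m S = Q then 1 else 0
  | zero_left => simp
  | zero_right => simp
  | add_left _ _ _ _ _ _ h1 h2 => rw [add_mul]; exact add_mem h1 h2
  | add_right _ _ _ _ _ _ h1 h2 => rw [mul_add]; exact add_mem h1 h2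
  | smul_left r _ _ _ _ h => rw [smul_mul_assoc]; exact Submodule.smul_mem _ _ h
  | smul_right r _ _ _ _ h => rw [mul_smul_comm]; exact Submodule.smul_mem _ _ h

theorem one_mem_statSpace : (1 : MR K) ∈ statSpace K b s := by
  rw [← mrOf_one]
  exact mrOf_stat_mem hs 0 fun _ => 1

/-- The subalgebra spanned by all sums over fibres of a local statistic. -/
def statAlg : Subalgebra K (MR K) :=
  (statSpace K b s).toSubalgebra (one_mem_statSpace hs) fun _ _ => mul_mem_statSpace hs

theorem toSubmodule_statAlg : Subalgebra.toSubmodule (statAlg (K := K) hs) = statSpace K b s :=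
  Submodule.toSubalgebra_toSubmodule _ _ _

theorem statAlg_le {A : Subalgebra K (MR K)} (h : ∀ n P, statSum K s n P ∈ A) :
    statAlg hs ≤ A := by
  have : statSpace K b s ≤ Subalgebra.toSubmodule A := by
    refine iSup_le fun n => Submodule.span_le.2 ?_
    rintro _ ⟨P, -, rfl⟩
    exact h n P
  exact this

end

/-- Neither segment sees the junction d, which may or may not be a descent; all other positions are
determined. -/
theorem statSum_Des_mul {d m : ℕ} {D : Finset ℕ} (hD : D ⊆ Finset.Icc 1 (d - 1)) (hd : 1 ≤ d)
    (hm : 1 ≤ m) : statSum K Des d D * statSum K Des m ∅ =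
      statSum K Des (d + m) D + statSum K Des (d + m) (insert d D) := by
  rw [statSum_mul_statSum isLocalStat_Des, statSum, statSum, ← mrOf_add]
  congr 1
  ext w
  have hS := isLocalStat_Des.subset_Icc w
  generalize Des w = S at hS
  have hD' : ∀ i ∈ D, 1 ≤ i ∧ i < d := fun i hi => by
    have := Finset.mem_Icc.1 (hD hi)
    omega
  have hS' : ∀ i ∈ S, 1 ≤ i ∧ i < d + m := fun i hi => by
    have := Finset.mem_Icc.1 (hS hi)
    omega
  have hdD : d ∉ D := fun h => by have := hD' d h; omega
  have key : (restr 1 0 d S = D ∧ restr 1 d m S = ∅) ↔ (S = D ∨ S = insert d D) := by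
    constructor
    · rintro ⟨h1, h2⟩
      have h3 : ∀ i, i ≠ d → (i ∈ S ↔ i ∈ D) := fun i hi => by
        rw [← h1, mem_restr, Nat.zero_add]
        refine ⟨fun h => ?_, fun h => h.2.2⟩
        have h4 := hS' i h
        refine ⟨h4.1, ?_, h⟩
        by_contra h5
        have : i - d ∈ restr 1 d m S := by
          rw [mem_restr]
          refine ⟨by omega, by omega, ?_⟩
          convert h using 1
          omega
        simp [h2] at this
      by_cases hd : d ∈ S
      · right
        ext i
        by_cases hi : i = d
        · simp [hi, hd]
        · simp [hi, h3 i hi]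
      · left
        ext i
        by_cases hi : i = d
        · simp [hi, hd, hdD]
        · exact h3 i hi
    · intro h
      constructor
      · ext i
        rw [mem_restr]
        rcases h with rfl | rfl
        · exact ⟨fun h => by simpa using h.2.2, fun h => by have := hD' i h; simp [h]; omega⟩
        · simp only [Nat.zero_add, Finset.mem_insert]
          exact ⟨fun h => by rcases h.2.2 with h' | h'; omega; exact h',
            fun h => ⟨(hD' i h).1, (hD' i h).2, Or.inr h⟩⟩
      · ext i
        rw [mem_restr]
        simp only [Finset.notMem_empty, iff_false]
        rintro ⟨h1, h2, h3⟩
        rcases h with rfl | rfl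
        · have := hD' _ h3; omega
        · rcases Finset.mem_insert.1 h3 with h3 | h3
          · omega
          · have := hD' _ h3; omega
  have hne : D ≠ insert d D := fun h => hdD (h ▸ Finset.mem_insert_self d D)
  by_cases h1 : S = D
  · subst h1
    simp [key, hne]
  · simp [key, h1]

/-- The two segments do not see the positions p and p + 1. At most one of them lies in S, which
leaves three cases. -/
theorem restr_peak_iff {p m : ℕ} {P S : Finset ℕ} (hP : P ⊆ Finset.Icc 2 (p - 1)) (hp : 2 ≤ p)
    (hS : S ⊆ Finset.Icc 2 (p + m - 1)) (hS2 : p ∈ S → p + 1 ∉ S) :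
    (restr 2 0 p S = P ∧ restr 2 p m S = ∅) ↔
      (S = P ∨ S = insert p P ∨ S = insert (p + 1) P) := by
  have hD' : ∀ i ∈ P, 2 ≤ i ∧ i < p := fun i hi => by
    have := Finset.mem_Icc.1 (hP hi)
    omega
  have hS' : ∀ i ∈ S, 2 ≤ i ∧ i < p + m := fun i hi => by
    have := Finset.mem_Icc.1 (hS hi)
    omega
  constructor
  · rintro ⟨h1, h2⟩
    have h3 : ∀ i, i ≠ p → i ≠ p + 1 → (i ∈ S ↔ i ∈ P) := fun i hi hi' => by
      rw [← h1, mem_restr, Nat.zero_add]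
      refine ⟨fun h => ?_, fun h => h.2.2⟩
      have h4 := hS' i h
      refine ⟨h4.1, ?_, h⟩
      by_contra h5
      have : i - p ∈ restr 2 p m S := by
        rw [mem_restr]
        refine ⟨by omega, by omega, ?_⟩
        convert h using 1
        omega
      simp [h2] at this
    have hpP : p ∉ P := fun h => by have := hD' _ h; omega
    have hpP' : p + 1 ∉ P := fun h => by have := hD' _ h; omega
    by_cases hp : p ∈ S
    · right; left
      ext i
      by_cases hi : i = p
      · simp [hi, hp]
      · by_cases hi' : i = p + 1
        · simp [hi', hS2 hp, hpP']
        · simp [hi, h3 i hi hi']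
    · by_cases hp' : p + 1 ∈ S
      · right; right
        ext i
        by_cases hi : i = p
        · simp [hi, hp, hpP]
        · by_cases hi' : i = p + 1
          · simp [hi', hp']
          · simp [hi', h3 i hi hi']
      · left
        ext i
        by_cases hi : i = p
        · simp [hi, hp, hpP]
        · by_cases hi' : i = p + 1
          · simp [hi', hp', hpP']
          · exact h3 i hi hi'
  · intro h
    constructor
    · ext i
      rw [mem_restr, Nat.zero_add]
      rcases h with rfl | rfl | rfl
      · exact ⟨fun h => h.2.2, fun h => ⟨(hD' i h).1, (hD' i h).2, h⟩⟩
      · simp only [Finset.mem_insert]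
        exact ⟨fun h => by rcases h.2.2 with h' | h'; omega; exact h',
          fun h => ⟨(hD' i h).1, (hD' i h).2, Or.inr h⟩⟩
      · simp only [Finset.mem_insert]
        exact ⟨fun h => by rcases h.2.2 with h' | h'; omega; exact h',
          fun h => ⟨(hD' i h).1, (hD' i h).2, Or.inr h⟩⟩
    · ext i
      rw [mem_restr]
      simp only [Finset.notMem_empty, iff_false]
      rintro ⟨h1, h2, h3⟩
      rcases h with rfl | rfl | rfl
      · have := hD' _ h3; omega
      · rcases Finset.mem_insert.1 h3 with h3 | h3
        · omega
        · have := hD' _ h3; omega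
      · rcases Finset.mem_insert.1 h3 with h3 | h3
        · omega
        · have := hD' _ h3; omega

theorem statSum_Peak_mul {p m : ℕ} {P : Finset ℕ} (hP : P ⊆ Finset.Icc 2 (p - 1)) (hp : 2 ≤ p) :
    statSum K Peak p P * statSum K Peak m ∅ =
      statSum K Peak (p + m) P + (statSum K Peak (p + m) (insert p P) +
        statSum K Peak (p + m) (insert (p + 1) P)) := by
  rw [statSum_mul_statSum isLocalStat_Peak, statSum, statSum, statSum, ← mrOf_add, ← mrOf_add]
  congr 1
  ext w
  have hS2 : p ∈ Peak w → p + 1 ∉ Peak w := fun h h' =>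
    ((mem_Peak w (p + 1)).1 h').2.2 ((mem_Peak w p).1 h).2.1
  have key := restr_peak_iff hP hp (isLocalStat_Peak.subset_Icc w) hS2
  have hpP : p ∉ P := fun h => by have := Finset.mem_Icc.1 (hP h); omega
  have hpP' : p + 1 ∉ P := fun h => by have := Finset.mem_Icc.1 (hP h); omega
  generalize Peak w = S at key
  have hne : P ≠ insert p P := fun h => hpP (h ▸ Finset.mem_insert_self p P)
  have hne' : P ≠ insert (p + 1) P := fun h => hpP' (h ▸ Finset.mem_insert_self (p + 1) P)
  have hne'' : insert p P ≠ insert (p + 1) P := fun h => by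
    have := h ▸ Finset.mem_insert_self p P
    simp [hpP] at this
  by_cases h1 : S = P
  · subst h1
    simp [key, hne, hne']
  · by_cases h2 : S = insert p P
    · subst h2
      simp [key, hne'', hpP]
    · simp [key, h1, h2]

theorem statSum_Des_mem_adjoin (n : ℕ) (D : Finset ℕ) :
    statSum K Des n D ∈ Algebra.adjoin K (Set.range fun n => statSum K Des n ∅) := by
  induction hk : D.card using Nat.strong_induction_on generalizing n D with
  | _ k ih =>
  by_cases hD : D ⊆ Finset.Icc 1 (n - 1)
  · rcases D.eq_empty_or_nonempty with rfl | hne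
    · exact Algebra.subset_adjoin ⟨n, rfl⟩
    · set d := D.max' hne with hd
      have hdD : d ∈ D := D.max'_mem hne
      have hd' := Finset.mem_Icc.1 (hD hdD)
      obtain ⟨m, rfl⟩ : ∃ m, n = d + m := ⟨n - d, by omega⟩
      have hcard : (D.erase d).card < k := by
        rw [← hk]
        exact Finset.card_erase_lt_of_mem hdD
      have h1 : D.erase d ⊆ Finset.Icc 1 (d - 1) := fun i hi => by
        have h2 := Finset.mem_of_mem_erase hi
        have h3 := Finset.mem_Icc.1 (hD h2)
        have h4 := D.le_max' i h2
        have h5 := Finset.ne_of_mem_erase hi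
        rw [Finset.mem_Icc]
        omega
      have h2 := statSum_Des_mul (K := K) h1 hd'.1 (m := m) (by omega)
      rw [Finset.insert_erase hdD] at h2
      -- Removing the largest descent d expresses Δ^D by sums with one descent fewer.
      rw [← sub_eq_iff_eq_add'.2 h2]
      exact sub_mem (mul_mem (ih _ hcard _ _ rfl) (Algebra.subset_adjoin ⟨m, rfl⟩))
        (ih _ hcard _ _ rfl)
  · rw [statSum_eq_zero isLocalStat_Des hD]
    exact zero_mem _

theorem statSum_Peak_mem_adjoin (n : ℕ) (P : Finset ℕ) :
    statSum K Peak n P ∈ Algebra.adjoin K (Set.range fun n => statSum K Peak n ∅) := by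
  -- The weight is chosen so that deleting the largest peak, moving it one step to the right, or
  -- truncating the degree to that peak all lower it. Counting peaks would not suffice, because the
  -- term with d + 1 in place of d has the same number.
  induction hk : ∑ i ∈ P, (n - i) using Nat.strong_induction_on generalizing n P with
  | _ k ih =>
  by_cases hD : P ⊆ Finset.Icc 2 (n - 1)
  · rcases P.eq_empty_or_nonempty with rfl | hne
    · exact Algebra.subset_adjoin ⟨n, rfl⟩
    · set d := P.max' hne with hd
      have hdD : d ∈ P := P.max'_mem hne
      have hd' := Finset.mem_Icc.1 (hD hdD)
      obtain ⟨m, rfl⟩ : ∃ m, n = d + m := ⟨n - d, by omega⟩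
      have h1 : P.erase d ⊆ Finset.Icc 2 (d - 1) := fun i hi => by
        have h2 := Finset.mem_of_mem_erase hi
        have h3 := Finset.mem_Icc.1 (hD h2)
        have h4 := P.le_max' i h2
        have h5 := Finset.ne_of_mem_erase hi
        rw [Finset.mem_Icc]
        omega
      have hnot : d + 1 ∉ P.erase d := fun h => by
        have := Finset.mem_Icc.1 (h1 h)
        omega
      have hk' := Finset.add_sum_erase P (fun i => d + m - i) hdD
      have h2 := statSum_Peak_mul (K := K) (m := m) h1 hd'.1
      rw [Finset.insert_erase hdD] at h2
      rw [add_left_comm] at h2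
      rw [← sub_eq_iff_eq_add.2 h2]
      refine sub_mem (mul_mem (ih _ ?_ _ _ rfl) (Algebra.subset_adjoin ⟨m, rfl⟩))
        (add_mem (ih _ ?_ _ _ rfl) (ih _ ?_ _ _ rfl))
      · have : ∑ i ∈ P.erase d, (d - i) ≤ ∑ i ∈ P.erase d, (d + m - i) :=
          Finset.sum_le_sum fun i _ => by omega
        omega
      · omega
      · rw [Finset.sum_insert hnot]
        omega
  · rw [statSum_eq_zero isLocalStat_Peak hD]
    exact zero_mem _

theorem statAlg_Des_eq : statAlg (K := K) isLocalStat_Des =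
    Algebra.adjoin K (Set.range fun n => statSum K Des n ∅) := by
  refine le_antisymm (statAlg_le _ statSum_Des_mem_adjoin) (Algebra.adjoin_le ?_)
  rintro _ ⟨n, rfl⟩
  exact statSum_mem isLocalStat_Des n ∅

theorem statAlg_Peak_eq : statAlg (K := K) isLocalStat_Peak =
    Algebra.adjoin K (Set.range fun n => statSum K Peak n ∅) := by
  refine le_antisymm (statAlg_le _ statSum_Peak_mem_adjoin) (Algebra.adjoin_le ?_)
  rintro _ ⟨n, rfl⟩
  exact statSum_mem isLocalStat_Peak n ∅

end

/-! ### Permutations without peaks as products of decreasing and increasing ones. -/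

theorem Des_eq_empty_iff {n : ℕ} (w : Equiv.Perm (Fin n)) : Des w = ∅ ↔ w = 1 := by
  constructor
  · intro h
    have h1 : StrictMono w := by
      rcases n with _ | n
      · exact fun i => i.elim0
      · rw [Fin.strictMono_iff_lt_succ]
        intro i
        have h2 : (i : ℕ) + 1 ∉ Des w := by simp [h]
        rw [mem_Des] at h2
        have h3 := letter_fin w i.castSucc
        have h4 := letter_fin w i.succ
        simp only [Fin.val_castSucc, Fin.val_succ] at h3 h4
        have h5 : w i.castSucc ≠ w i.succ := fun h => by
          have := w.injective h
          simp [Fin.ext_iff] at this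
        have h6 : (w i.castSucc : ℕ) ≠ w i.succ := fun h => h5 (Fin.ext h)
        rw [Fin.lt_def]
        omega
    exact perm_eq_of_lt_iff fun i j => by simp [h1.lt_iff_lt]
  · rintro rfl
    ext i
    simp only [mem_Des, Finset.notMem_empty, iff_false]
    rintro ⟨h1, h2, h3⟩
    rw [letter_eq _ h1 (by omega), letter_eq _ (by omega) h2] at h3
    simp at h3
    omega

/-- If k + 1 is a descent and k ≥ 1 is not, then k + 1 is a peak. Without peaks the descent set is
therefore closed downwards. -/
theorem exists_Des_eq_Icc {n : ℕ} (w : Equiv.Perm (Fin n)) (h : Peak w = ∅) :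
    ∃ j, Des w = Finset.Icc 1 j := by
  rcases (Des w).eq_empty_or_nonempty with h0 | hne
  · exact ⟨0, by simpa using h0⟩
  · refine ⟨(Des w).max' hne, ?_⟩
    ext i
    rw [Finset.mem_Icc]
    constructor
    · exact fun hi => ⟨((mem_Des w i).1 hi).1, Finset.le_max' _ _ hi⟩
    · rintro ⟨h1, h2⟩
      induction h2 using Nat.decreasingInduction with
      | self => exact Finset.max'_mem _ _
      | of_succ k _ ih =>
        have h3 := ih (by omega)
        have h4 : k + 1 ∉ Peak w := by simp [h]
        rw [mem_Peak] at h4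
        by_contra h5
        exact h4 ⟨by omega, h3, by simpa using h5⟩

theorem Peak_eq_empty_of_Des_eq_Icc {n j : ℕ} (w : Equiv.Perm (Fin n))
    (h : Des w = Finset.Icc 1 j) : Peak w = ∅ := by
  ext i
  simp only [mem_Peak, h, Finset.mem_Icc, Finset.notMem_empty, iff_false]
  omega

theorem Icc_one_injective {j k : ℕ} (h : Finset.Icc 1 j = Finset.Icc 1 k) : j = k := by
  simpa using congrArg Finset.card h

noncomputable section

variable (K : Type u) [Field K]

/-- The increasing permutation of degree `n`. -/
def incr (n : ℕ) : MR K := statSum K Des n ∅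

/-- The decreasing permutation of degree `n`. -/
def decr (n : ℕ) : MR K := statSum K Des n (Finset.Icc 1 (n - 1))

/-- The sum of all permutations in `S_n` that decrease exactly until position `k`. -/
def valley (n k : ℕ) : MR K :=
  mrOf K n fun w => if 1 ≤ k ∧ k ≤ n ∧ Des w = Finset.Icc 1 (k - 1) then 1 else 0

variable {K}

theorem incr_eq (n : ℕ) : incr K n = mrOf K n fun w => if w = 1 then 1 else 0 := by
  simp only [incr, statSum, Des_eq_empty_iff]

theorem incr_zero : incr K 0 = 1 := by
  rw [incr_eq, ← mrOf_one]
  congr 1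

theorem decr_zero : decr K 0 = 1 := by
  rw [← incr_zero]
  rfl

theorem restr_valley_iff {k m : ℕ} {S : Finset ℕ} (hS : S ⊆ Finset.Icc 1 (k + m - 1))
    (hn : 1 ≤ k + m) :
    (restr 1 0 k S = Finset.Icc 1 (k - 1) ∧ restr 1 k m S = ∅) ↔
      ((1 ≤ k ∧ k ≤ k + m ∧ S = Finset.Icc 1 (k - 1)) ∨
        (1 ≤ k + 1 ∧ k + 1 ≤ k + m ∧ S = Finset.Icc 1 (k + 1 - 1))) := by
  have hS' : ∀ i ∈ S, 1 ≤ i ∧ i < k + m := fun i hi => by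
    have := Finset.mem_Icc.1 (hS hi)
    omega
  constructor
  · rintro ⟨h1, h2⟩
    have h3 : ∀ i, i ≠ k → (i ∈ S ↔ 1 ≤ i ∧ i < k) := fun i hi => by
      have h4 : i ∈ restr 1 0 k S ↔ i ∈ Finset.Icc 1 (k - 1) := by rw [h1]
      rw [mem_restr, Finset.mem_Icc, Nat.zero_add] at h4
      refine ⟨fun h => ?_, fun h => (h4.2 ⟨by omega, by omega⟩).2.2⟩
      refine ⟨(hS' i h).1, ?_⟩
      by_contra h5
      have h6 := hS' i h
      have : i - k ∈ restr 1 k m S := by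
        rw [mem_restr]
        refine ⟨by omega, by omega, ?_⟩
        convert h using 1
        omega
      simp [h2] at this
    by_cases hk : k ∈ S
    · right
      refine ⟨by omega, (hS' k hk).2, ?_⟩
      ext i
      rw [Finset.mem_Icc]
      by_cases hi : i = k
      · have := hS' k hk
        simp [hi, hk]
        omega
      · rw [h3 i hi]
        omega
    · have hSk : S = Finset.Icc 1 (k - 1) := by
        ext i
        rw [Finset.mem_Icc]
        by_cases hi : i = k
        · simp [hi, hk]
          omega
        · rw [h3 i hi]
          omega
      rcases Nat.eq_zero_or_pos k with rfl | h
      · right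
        exact ⟨by omega, by omega, hSk⟩
      · left
        exact ⟨h, by omega, hSk⟩
  · rintro (⟨h1, h2, rfl⟩ | ⟨h1, h2, rfl⟩)
    · constructor
      · ext i
        simp only [mem_restr, Finset.mem_Icc]
        omega
      · ext i
        simp only [mem_restr, Finset.mem_Icc, Finset.notMem_empty, iff_false]
        omega
    · constructor
      · ext i
        simp only [mem_restr, Finset.mem_Icc]
        omega
      · ext i
        simp only [mem_restr, Finset.mem_Icc, Finset.notMem_empty, iff_false]
        omega

theorem ite_or_eq_add {p q : Prop} [Decidable p] [Decidable q] (h : ¬ (p ∧ q)) :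
    (if p ∨ q then (1 : K) else 0) = (if p then 1 else 0) + if q then 1 else 0 := by
  by_cases hp : p <;> by_cases hq : q <;> simp_all

/-- If the first k letters fall and the last m rise, the minimum is at position k or k + 1,
according to the step between them. The range condition in `valley` drops the impossible cases k = 0
and m = 0, and it also prevents the truncated k - 1 from identifying k = 0 with k = 1. -/
theorem decr_mul_incr {k m : ℕ} (hn : 1 ≤ k + m) :
    decr K k * incr K m = valley K (k + m) k + valley K (k + m) (k + 1) := by
  rw [decr, incr, statSum_mul_statSum isLocalStat_Des, valley, valley, ← mrOf_add]
  congr 1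
  ext w
  have key := restr_valley_iff (isLocalStat_Des.subset_Icc w) hn
  have hne : ¬ ((1 ≤ k ∧ k ≤ k + m ∧ Des w = Finset.Icc 1 (k - 1)) ∧
      (1 ≤ k + 1 ∧ k + 1 ≤ k + m ∧ Des w = Finset.Icc 1 (k + 1 - 1))) := by
    rintro ⟨⟨h1, -, h2⟩, -, -, h3⟩
    have := Icc_one_injective (h2.symm.trans h3)
    omega
  simp only [key]
  exact ite_or_eq_add hne

theorem valley_zero (n : ℕ) : valley K n 0 = 0 := by simp [valley, mrOf_zero]

theorem valley_succ_self (n : ℕ) : valley K n (n + 1) = 0 := by simp [valley, mrOf_zero]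

theorem sum_valley (n : ℕ) (hn : 1 ≤ n) :
    ∑ k ∈ Finset.range (n + 1), valley K n k = statSum K Peak n ∅ := by
  simp only [valley]
  rw [← mrOf_sum, statSum]
  congr 1
  ext w
  by_cases h : Peak w = ∅
  · obtain ⟨j, hj⟩ := exists_Des_eq_Icc w h
    have hjn : j + 1 ≤ n := by
      rcases Nat.eq_zero_or_pos j with rfl | hj0
      · exact hn
      · have : j ∈ Des w := by simp [hj, Nat.succ_le_iff, hj0]
        exact ((mem_Des w j).1 this).2.1
    rw [if_pos h, Finset.sum_eq_single (j + 1), if_pos ⟨by omega, hjn, hj⟩]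
    · intro b _ hb
      rw [if_neg]
      rintro ⟨h1, h2, h3⟩
      have := Icc_one_injective (hj.symm.trans h3)
      omega
    · intro h
      simp at h
      omega
  · rw [if_neg h]
    refine Finset.sum_eq_zero fun k _ => if_neg fun h1 => h ?_
    exact Peak_eq_empty_of_Des_eq_Icc w h1.2.2

/-- Each valley position k is produced twice, by the factorizations at k - 1 and at k; the boundary
terms at 0 and n + 1 vanish. -/
theorem sum_decr_mul_incr (n : ℕ) (hn : 1 ≤ n) :
    ∑ p ∈ Finset.HasAntidiagonal.antidiagonal n, decr K p.1 * incr K p.2 = (2 : K) • statSum K Peak n ∅ := by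
  rw [Finset.Nat.sum_antidiagonal_eq_sum_range_succ_mk]
  have h1 : ∀ k ∈ Finset.range n.succ, decr K (k, n - k).1 * incr K (k, n - k).2 =
      valley K n k + valley K n (k + 1) := fun k hk => by
    have hk' : k + (n - k) = n := by
      have := Finset.mem_range.1 hk
      omega
    have := decr_mul_incr (K := K) (k := k) (m := n - k) (by omega)
    rw [hk'] at this
    exact this
  rw [Finset.sum_congr rfl h1, Finset.sum_add_distrib, sum_valley n hn]
  have h2 := Finset.sum_range_succ' (valley K n) (n + 1)
  rw [Finset.sum_range_succ, sum_valley n hn, valley_succ_self, valley_zero, add_zero,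
    add_zero] at h2
  rw [← h2, two_smul]

theorem alternating_sum_add {M : Type*} [AddCommGroup M] [Module K M] (f : ℕ → M) (N : ℕ) :
    ∑ k ∈ Finset.range N, (-1 : K) ^ k • (f k + f (k + 1)) = f 0 - (-1 : K) ^ N • f N := by
  induction N with
  | zero => simp
  | succ N ih =>
    rw [Finset.sum_range_succ, ih, smul_add, pow_succ]
    simp only [mul_neg, mul_one, neg_smul]
    abel

/-- With signs the same sum telescopes to zero: up to signs, the series of decreasing permutations
inverts the series of increasing ones. -/
theorem alternating_sum_decr_mul_incr (n : ℕ) (hn : 1 ≤ n) :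
    ∑ p ∈ Finset.HasAntidiagonal.antidiagonal n, ((-1 : K) ^ p.1 • decr K p.1) * incr K p.2 = 0 := by
  rw [Finset.Nat.sum_antidiagonal_eq_sum_range_succ_mk]
  have h1 : ∀ k ∈ Finset.range n.succ,
      ((-1 : K) ^ (k, n - k).1 • decr K (k, n - k).1) * incr K (k, n - k).2 =
      (-1 : K) ^ k • (valley K n k + valley K n (k + 1)) := fun k hk => by
    have hk' : k + (n - k) = n := by
      have := Finset.mem_range.1 hk
      omega
    have := decr_mul_incr (K := K) (k := k) (m := n - k) (by omega)
    rw [hk'] at this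
    rw [smul_mul_assoc, this]
  rw [Finset.sum_congr rfl h1, alternating_sum_add, valley_zero, Nat.succ_eq_add_one,
    valley_succ_self]
  simp

end

/-! ### Power series over a noncommutative algebra with f(t) f(-t) = 1. -/

theorem sum_antidiagonal_assoc {M : Type*} [AddCommMonoid M] (n : ℕ) (F : ℕ → ℕ → ℕ → M) :
    ∑ p ∈ antidiagonal n, ∑ q ∈ antidiagonal p.1, F q.1 q.2 p.2 =
      ∑ p ∈ antidiagonal n, ∑ q ∈ antidiagonal p.2, F p.1 q.1 q.2 := by
  rw [Finset.sum_sigma', Finset.sum_sigma']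
  refine Finset.sum_nbij' (fun x => ⟨(x.2.1, x.2.2 + x.1.2), (x.2.2, x.1.2)⟩)
    (fun x => ⟨(x.1.1 + x.2.1, x.2.2), (x.1.1, x.2.1)⟩) ?_ ?_ ?_ ?_ ?_
  · rintro ⟨⟨a, b⟩, ⟨c, d⟩⟩ h
    simp only [Finset.mem_sigma, Finset.HasAntidiagonal.mem_antidiagonal] at h ⊢
    obtain ⟨rfl, rfl⟩ := h
    exact ⟨by omega, trivial⟩
  · rintro ⟨⟨a, b⟩, ⟨c, d⟩⟩ h
    simp only [Finset.mem_sigma, Finset.HasAntidiagonal.mem_antidiagonal] at h ⊢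
    obtain ⟨rfl, rfl⟩ := h
    exact ⟨by omega, trivial⟩
  · rintro ⟨⟨a, b⟩, ⟨c, d⟩⟩ h
    simp only [Finset.mem_sigma, Finset.HasAntidiagonal.mem_antidiagonal] at h
    obtain ⟨h, rfl⟩ := h
    rfl
  · rintro ⟨⟨a, b⟩, ⟨c, d⟩⟩ h
    simp only [Finset.mem_sigma, Finset.HasAntidiagonal.mem_antidiagonal] at h
    obtain ⟨h, rfl⟩ := h
    rfl
  · intro x _
    rfl

/-- Isolates the two terms of a Cauchy product that involve the top coefficients; n ≥ 1 keeps them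
distinct. -/
theorem sum_antidiagonal_ends {M : Type*} [AddCommMonoid M] {n : ℕ} (hn : 1 ≤ n)
    (F : ℕ × ℕ → M) : ∑ p ∈ antidiagonal n, F p =
      F (0, n) + F (n, 0) + ∑ p ∈ (antidiagonal n).filter fun p => p.1 < n ∧ p.2 < n, F p := by
  have h0 : (0, n) ∈ antidiagonal n := by simp
  have h1 : (n, 0) ∈ (antidiagonal n).erase (0, n) := by
    simp
    omega
  rw [← Finset.add_sum_erase _ _ h0, ← Finset.add_sum_erase _ _ h1, add_assoc]
  congr 3
  ext ⟨a, b⟩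
  simp only [Finset.mem_erase, Finset.mem_filter, Finset.HasAntidiagonal.mem_antidiagonal, Prod.mk.injEq, ne_eq]
  omega

noncomputable section

section Alternate

variable (K : Type u) [Field K] {R : Type*} [Ring R] [Algebra K R]

/-- The power series `f(-t)`. -/
def alt (f : PowerSeries R) : PowerSeries R :=
  PowerSeries.mk fun n => (-1 : K) ^ n • PowerSeries.coeff n f

variable {K}

theorem coeff_alt (f : PowerSeries R) (n : ℕ) :
    PowerSeries.coeff n (alt K f) = (-1 : K) ^ n • PowerSeries.coeff n f :=
  PowerSeries.coeff_mk _ _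

theorem alt_mul (f g : PowerSeries R) : alt K (f * g) = alt K f * alt K g := by
  ext n
  simp only [coeff_alt, PowerSeries.coeff_mul, Finset.smul_sum]
  refine Finset.sum_congr rfl fun p hp => ?_
  rw [← Finset.HasAntidiagonal.mem_antidiagonal.1 hp, pow_add, smul_mul_smul_comm]

theorem alt_one : alt K (1 : PowerSeries R) = 1 := by
  ext n
  rw [coeff_alt, PowerSeries.coeff_one]
  split_ifs with h
  · simp [h]
  · simp

theorem alt_add (f g : PowerSeries R) : alt K (f + g) = alt K f + alt K g := by
  ext n
  simp [coeff_alt]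

theorem alt_smul (c : K) (f : PowerSeries R) : alt K (c • f) = c • alt K f := by
  ext n
  simp only [coeff_alt, PowerSeries.coeff_smul, smul_comm c]

theorem alt_alt (f : PowerSeries R) : alt K (alt K f) = f := by
  ext n
  simp [coeff_alt, smul_smul, ← mul_pow]

theorem map_alt {S : Type*} [Ring S] [Algebra K S] (φ : R →ₐ[K] S) (f : PowerSeries R) :
    PowerSeries.map (φ : R →+* S) (alt K f) = alt K (PowerSeries.map (φ : R →+* S) f) := by
  ext n
  simp [coeff_alt]

/-- In even degree n > 0 the relation reads 2 f_n + (products of lower coefficients) = 0, so f_n can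
be solved for. -/
theorem coeff_mem_of_mul_alt_eq_one [CharZero K] {f : PowerSeries R} (h0 : PowerSeries.coeff 0 f = 1)
    (h : f * alt K f = 1) (A : Subalgebra K R)
    (hA : ∀ n, Odd n → PowerSeries.coeff n f ∈ A) (n : ℕ) : PowerSeries.coeff n f ∈ A := by
  induction n using Nat.strong_induction_on with
  | _ n ih =>
  rcases Nat.even_or_odd n with hn | hn
  · rcases Nat.eq_zero_or_pos n with rfl | hpos
    · rw [h0]
      exact one_mem A
    · have h1 := congrArg (PowerSeries.coeff n) h
      rw [PowerSeries.coeff_mul, sum_antidiagonal_ends hpos, PowerSeries.coeff_one,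
        if_neg hpos.ne'] at h1
      simp only [coeff_alt, h0, hn.neg_one_pow, one_smul, one_mul, pow_zero, mul_one] at h1
      rw [← two_smul K] at h1
      have h2 := eq_neg_of_add_eq_zero_left h1
      have h3 : PowerSeries.coeff n f = (2 : K)⁻¹ • ((2 : K) • PowerSeries.coeff n f) := by
        rw [smul_smul, inv_mul_cancel₀ two_ne_zero, one_smul]
      rw [h3, h2]
      refine A.smul_mem (neg_mem (sum_mem fun p hp => ?_)) _
      have hp' := (Finset.mem_filter.1 hp).2
      exact mul_mem (ih _ hp'.1) (A.smul_mem (ih _ hp'.2) _)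
  · exact hA n hn

/-- The coefficients of the power series with prescribed odd coefficients `o`, constant coefficient
`1` and the even coefficients of `f(t) f(-t)` vanishing. -/
def reciprocalCoeff (K : Type u) [Field K] {R : Type*} [Ring R] [Algebra K R] (o : ℕ → R)
    (n : ℕ) : R :=
  if n = 0 then 1 else if Odd n then o n else
    -(2 : K)⁻¹ • ∑ p ∈ ((antidiagonal n).filter fun p => p.1 < n ∧ p.2 < n).attach,
      reciprocalCoeff K o p.1.1 * (-1 : K) ^ p.1.2 • reciprocalCoeff K o p.1.2
termination_by n
decreasing_by
  · exact (Finset.mem_filter.1 p.2).2.1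
  · exact (Finset.mem_filter.1 p.2).2.2

/-- The recursion enforces the relation in even degrees only. In odd degrees it must be deduced, and
without commutativity the terms do not cancel in pairs. -/
theorem exists_mul_alt_eq_one [CharZero K] (o : ℕ → R) : ∃ f : PowerSeries R,
    PowerSeries.coeff 0 f = 1 ∧ (∀ n, Odd n → PowerSeries.coeff n f = o n) ∧ f * alt K f = 1 := by
  set f : PowerSeries R := PowerSeries.mk (reciprocalCoeff K o) with hf
  have h0 : PowerSeries.coeff 0 f = 1 := by
    rw [hf, PowerSeries.coeff_mk, reciprocalCoeff, if_pos rfl]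
  refine ⟨f, h0, fun n hn => ?_, ?_⟩
  · rw [hf, PowerSeries.coeff_mk, reciprocalCoeff, if_neg hn.pos.ne', if_pos hn]
  · obtain ⟨v, hv⟩ : ∃ v, f * alt K f = 1 + v := ⟨f * alt K f - 1, by abel⟩
    have heven : ∀ n, Even n → PowerSeries.coeff n v = 0 := fun n hn => by
      have h1 := congrArg (PowerSeries.coeff n) hv
      rw [map_add, PowerSeries.coeff_one] at h1
      rcases Nat.eq_zero_or_pos n with rfl | hpos
      · rw [PowerSeries.coeff_mul] at h1
        simpa [coeff_alt, -PowerSeries.coeff_zero_eq_constantCoeff, h0] using h1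
      · rw [PowerSeries.coeff_mul, sum_antidiagonal_ends hpos, if_neg hpos.ne', zero_add] at h1
        simp only [coeff_alt, h0, hn.neg_one_pow, one_smul, one_mul, pow_zero, mul_one] at h1
        rw [← h1, ← two_smul K]
        have h2 : PowerSeries.coeff n f =
            -(2 : K)⁻¹ • ∑ p ∈ (antidiagonal n).filter fun p => p.1 < n ∧ p.2 < n,
              PowerSeries.coeff p.1 f * (-1 : K) ^ p.2 • PowerSeries.coeff p.2 f := by
          rw [← Finset.sum_attach]
          conv_lhs => rw [hf, PowerSeries.coeff_mk, reciprocalCoeff, if_neg hpos.ne',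
            if_neg (Nat.not_odd_iff_even.2 hn)]
          simp [hf, PowerSeries.coeff_mk]
        rw [h2, smul_smul, mul_neg, mul_inv_cancel₀ two_ne_zero, neg_one_smul, neg_add_cancel]
    -- The error v is an odd series, so f(t) f(-t) = 1 + v gives f(-t) f(t) = 1 - v.
    have halt : alt K v = -v := by
      ext n
      rw [coeff_alt, map_neg]
      rcases Nat.even_or_odd n with hn | hn
      · simp [heven n hn]
      · simp [hn.neg_one_pow]
    have h1 : alt K f * f = 1 - v := by
      have := congrArg (alt K) hv
      rwa [alt_mul, alt_alt, alt_add, alt_one, halt, ← sub_eq_add_neg] at this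
    -- The two bracketings of f(t) f(-t) f(t) are f - f v and f + v f.
    have h2 : f * v + v * f = 0 := by
      have h3 : f * (alt K f * f) = f * alt K f * f := (mul_assoc _ _ _).symm
      rw [h1, hv, mul_sub, add_mul, mul_one, one_mul] at h3
      have h4 : f * v + v * f = (f + v * f) - (f - f * v) := by abel
      rw [h4, h3, sub_self]
    -- Once the lower coefficients of v vanish, the degree n part of f v + v f is 2 v_n, because f
    -- has constant term 1.
    have h5 : ∀ n, PowerSeries.coeff n v = 0 := fun n => by
      induction n using Nat.strong_induction_on with
      | _ n ih =>
      have h6 := congrArg (PowerSeries.coeff n) h2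
      rw [map_add, PowerSeries.coeff_mul, PowerSeries.coeff_mul, map_zero,
        Finset.sum_eq_single (0, n), Finset.sum_eq_single (n, 0)] at h6
      · simp only [h0, one_mul, mul_one] at h6
        rw [← two_smul K] at h6
        exact (smul_eq_zero_iff_right (two_ne_zero (α := K))).1 h6
      · rintro ⟨a, b⟩ hab hne
        rw [Finset.HasAntidiagonal.mem_antidiagonal] at hab
        simp only at hab
        rw [ih a, zero_mul]
        by_contra h
        exact hne (by ext <;> simp <;> omega)
      · simp
      · rintro ⟨a, b⟩ hab hne
        rw [Finset.HasAntidiagonal.mem_antidiagonal] at hab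
        simp only at hab
        rw [ih b, mul_zero]
        by_contra h
        exact hne (by ext <;> simp <;> omega)
      · simp
    have h7 : v = 0 := by
      ext n
      simpa using h5 n
    rw [hv, h7, add_zero]

end Alternate

end

/-! ### The Hopf algebra of noncommutative symmetric functions. -/

noncomputable section

variable (K : Type u) [Field K]

/-- The algebra of noncommutative symmetric functions: the free algebra on one generator in each
positive degree. -/
abbrev NSym : Type u := FreeAlgebra K ℕ

/-- The complete noncommutative symmetric functions. -/
def complete : ℕ → NSym K
  | 0 => 1
  | n + 1 => FreeAlgebra.ι K n

/-- The coproduct of `NSym`. -/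
def nsymComul : NSym K →ₐ[K] NSym K ⊗[K] NSym K :=
  FreeAlgebra.lift K fun n =>
    ∑ p ∈ antidiagonal (n + 1), complete K p.1 ⊗ₜ[K] complete K p.2

/-- The counit of `NSym`. -/
def nsymCounit : NSym K →ₐ[K] K := FreeAlgebra.lift K fun _ => 0

variable {K}

theorem nsymComul_complete (n : ℕ) : nsymComul K (complete K n) =
    ∑ p ∈ antidiagonal n, complete K p.1 ⊗ₜ[K] complete K p.2 := by
  cases n with
  | zero => simp [complete, Algebra.TensorProduct.one_def]
  | succ n => simp [complete, nsymComul]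

theorem nsymCounit_complete (n : ℕ) : nsymCounit K (complete K n) = if n = 0 then 1 else 0 := by
  cases n with
  | zero => simp [complete]
  | succ n => simp [complete, nsymCounit]

theorem nsym_hom_ext {B : Type*} [Semiring B] [Algebra K B] {f g : NSym K →ₐ[K] B}
    (h : ∀ n, f (complete K n) = g (complete K n)) : f = g :=
  FreeAlgebra.hom_ext (funext fun n => h (n + 1))

theorem nsym_induction {p : NSym K → Prop} (scalar : ∀ r, p (algebraMap K _ r))
    (gen : ∀ n, p (complete K n)) (mul : ∀ a b, p a → p b → p (a * b))
    (add : ∀ a b, p a → p b → p (a + b)) (x : NSym K) : p x :=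
  FreeAlgebra.induction K ℕ scalar (fun n => gen (n + 1)) mul add x

instance : Bialgebra K (NSym K) :=
  Bialgebra.ofAlgHom (nsymComul K) (nsymCounit K)
    (nsym_hom_ext fun n => by
      simp only [AlgHom.coe_comp, Function.comp_apply, nsymComul_complete, map_sum,
        Algebra.TensorProduct.map_tmul, AlgHom.coe_id, id_eq, TensorProduct.sum_tmul,
        TensorProduct.tmul_sum]
      exact sum_antidiagonal_assoc n fun i j k =>
        complete K i ⊗ₜ[K] (complete K j ⊗ₜ[K] complete K k))
    (nsym_hom_ext fun n => by
      simp only [AlgHom.coe_comp, Function.comp_apply, nsymComul_complete, map_sum,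
        Algebra.TensorProduct.map_tmul, AlgHom.coe_id, id_eq, nsymCounit_complete]
      rw [Finset.sum_eq_single (0, n)]
      · simp
      · rintro ⟨a, b⟩ hab hne
        rw [Finset.HasAntidiagonal.mem_antidiagonal] at hab
        rw [if_neg, TensorProduct.zero_tmul]
        simp only at hab ⊢
        rintro rfl
        exact hne (by simpa using hab)
      · simp)
    (nsym_hom_ext fun n => by
      simp only [AlgHom.coe_comp, Function.comp_apply, nsymComul_complete, map_sum,
        Algebra.TensorProduct.map_tmul, AlgHom.coe_id, id_eq, nsymCounit_complete]
      rw [Finset.sum_eq_single (n, 0)]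
      · simp
      · rintro ⟨a, b⟩ hab hne
        rw [Finset.HasAntidiagonal.mem_antidiagonal] at hab
        rw [if_neg, TensorProduct.tmul_zero]
        simp only at hab ⊢
        rintro rfl
        exact hne (by simpa using hab)
      · simp)

variable (K)

/-- The generating series of the complete noncommutative symmetric functions. -/
def completeSeries : PowerSeries (NSym K) := PowerSeries.mk (complete K)

/-- The inverse of the generating series of the complete noncommutative symmetric functions. -/
def inverseSeries : PowerSeries (NSym K) := PowerSeries.invOfUnit (completeSeries K) 1

variable {K}

theorem coeff_completeSeries (n : ℕ) : PowerSeries.coeff n (completeSeries K) = complete K n :=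
  PowerSeries.coeff_mk _ _

theorem constantCoeff_completeSeries :
    PowerSeries.constantCoeff (completeSeries K) = ((1 : (NSym K)ˣ) : NSym K) := by
  rw [← PowerSeries.coeff_zero_eq_constantCoeff_apply, coeff_completeSeries]
  rfl

theorem completeSeries_mul_inverseSeries : completeSeries K * inverseSeries K = 1 :=
  PowerSeries.mul_invOfUnit _ _ constantCoeff_completeSeries

theorem inverseSeries_mul_completeSeries : inverseSeries K * completeSeries K = 1 :=
  PowerSeries.invOfUnit_mul _ _ constantCoeff_completeSeries

theorem coeff_zero_inverseSeries : PowerSeries.coeff 0 (inverseSeries K) = 1 := by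
  simp [inverseSeries]

variable (K)

/-- The antipode of `NSym`, as a homomorphism to the opposite algebra. -/
def nsymAntipodeHom : NSym K →ₐ[K] (NSym K)ᵐᵒᵖ :=
  FreeAlgebra.lift K fun n => MulOpposite.op (PowerSeries.coeff (n + 1) (inverseSeries K))

/-- The antipode of `NSym`. -/
def nsymAntipode : NSym K →ₗ[K] NSym K :=
  (MulOpposite.opLinearEquiv K).symm.toLinearMap ∘ₗ (nsymAntipodeHom K).toLinearMap

variable {K}

theorem nsymAntipode_mul (a b : NSym K) :
    nsymAntipode K (a * b) = nsymAntipode K b * nsymAntipode K a := by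
  simp [nsymAntipode]

theorem nsymAntipode_algebraMap (r : K) :
    nsymAntipode K (algebraMap K _ r) = algebraMap K _ r := by
  simp [nsymAntipode]

theorem nsymAntipode_one : nsymAntipode K 1 = 1 := by
  simp [nsymAntipode]

theorem nsymAntipode_complete (n : ℕ) :
    nsymAntipode K (complete K n) = PowerSeries.coeff n (inverseSeries K) := by
  cases n with
  | zero =>
    rw [coeff_zero_inverseSeries]
    simp [complete, nsymAntipode]
  | succ n => simp [complete, nsymAntipode, nsymAntipodeHom]

/-- Since the antipode reverses products, multiplying by a pure tensor on the right wraps its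
factors around the value at T. As that value is a scalar for T = Δ(a), the antipode axiom passes
from factors to products. -/
theorem mul_rTensor_tmul_mul (T : NSym K ⊗[K] NSym K) (b c : NSym K) :
    LinearMap.mul' K (NSym K) ((nsymAntipode K).rTensor _ (T * b ⊗ₜ[K] c)) =
      nsymAntipode K b * LinearMap.mul' K (NSym K) ((nsymAntipode K).rTensor _ T) * c := by
  induction T with
  | zero => simp
  | add x y hx hy => simp only [add_mul, map_add, hx, hy, mul_add]
  | tmul x y => simp [nsymAntipode_mul, mul_assoc]

theorem mul_lTensor_tmul_mul (T : NSym K ⊗[K] NSym K) (b c : NSym K) :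
    LinearMap.mul' K (NSym K) ((nsymAntipode K).lTensor _ (b ⊗ₜ[K] c * T)) =
      b * LinearMap.mul' K (NSym K) ((nsymAntipode K).lTensor _ T) * nsymAntipode K c := by
  induction T with
  | zero => simp
  | add x y hx hy => simp only [add_mul, map_add, hx, hy, mul_add]
  | tmul x y => simp [nsymAntipode_mul, mul_assoc]

theorem mul_rTensor_comul (x : NSym K) :
    LinearMap.mul' K (NSym K) ((nsymAntipode K).rTensor _ (nsymComul K x)) =
      algebraMap K _ (nsymCounit K x) := by
  induction x using nsym_induction with
  | scalar r =>
    rw [AlgHom.commutes, AlgHom.commutes, Algebra.TensorProduct.algebraMap_apply]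
    simp [nsymAntipode_algebraMap]
  | add a b ha hb => simp only [map_add, ha, hb]
  | gen n =>
    -- On generators the antipode axiom is the coefficientwise form of σ(t)⁻¹ σ(t) = 1.
    have h := congrArg (PowerSeries.coeff n) (inverseSeries_mul_completeSeries (K := K))
    rw [PowerSeries.coeff_mul, PowerSeries.coeff_one] at h
    simp only [nsymComul_complete, map_sum, LinearMap.rTensor_tmul, LinearMap.mul'_apply,
      nsymAntipode_complete, nsymCounit_complete]
    simp only [coeff_completeSeries] at h
    rw [h]
    split_ifs <;> simp
  | mul a b ha hb =>
    have key : ∀ U : NSym K ⊗[K] NSym K,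
        LinearMap.mul' K (NSym K) ((nsymAntipode K).rTensor _ (nsymComul K a * U)) =
        algebraMap K _ (nsymCounit K a) *
          LinearMap.mul' K (NSym K) ((nsymAntipode K).rTensor _ U) := fun U => by
      induction U with
      | zero => simp
      | add x y hx hy => simp only [mul_add, map_add, hx, hy]
      | tmul x y =>
        rw [mul_rTensor_tmul_mul, ha, ← Algebra.commutes]
        simp [mul_assoc]
    rw [map_mul, key, hb, map_mul, map_mul]

theorem mul_lTensor_comul (x : NSym K) :
    LinearMap.mul' K (NSym K) ((nsymAntipode K).lTensor _ (nsymComul K x)) =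
      algebraMap K _ (nsymCounit K x) := by
  induction x using nsym_induction with
  | scalar r =>
    rw [AlgHom.commutes, AlgHom.commutes, Algebra.TensorProduct.algebraMap_apply]
    simp [nsymAntipode_one]
  | add a b ha hb => simp only [map_add, ha, hb]
  | gen n =>
    have h := congrArg (PowerSeries.coeff n) (completeSeries_mul_inverseSeries (K := K))
    rw [PowerSeries.coeff_mul, PowerSeries.coeff_one] at h
    simp only [nsymComul_complete, map_sum, LinearMap.lTensor_tmul, LinearMap.mul'_apply,
      nsymAntipode_complete, nsymCounit_complete]
    simp only [coeff_completeSeries] at h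
    rw [h]
    split_ifs <;> simp
  | mul a b ha hb =>
    have key : ∀ U : NSym K ⊗[K] NSym K,
        LinearMap.mul' K (NSym K) ((nsymAntipode K).lTensor _ (U * nsymComul K b)) =
        LinearMap.mul' K (NSym K) ((nsymAntipode K).lTensor _ U) *
          algebraMap K _ (nsymCounit K b) := fun U => by
      induction U with
      | zero => simp
      | add x y hx hy => simp only [add_mul, map_add, hx, hy]
      | tmul x y =>
        rw [mul_lTensor_tmul_mul, hb, mul_assoc, Algebra.commutes]
        simp [mul_assoc]
    rw [map_mul, key, ha, map_mul, map_mul]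

instance : HopfAlgebra K (NSym K) where
  antipode := nsymAntipode K
  mul_antipode_rTensor_comul := LinearMap.ext mul_rTensor_comul
  mul_antipode_lTensor_comul := LinearMap.ext mul_lTensor_comul

/-! ### Group-like series, and the peak series. -/

/-- A power series over `NSym` whose coefficients form a divided power sequence. -/
def IsDividedPower (f : PowerSeries (NSym K)) : Prop :=
  ∀ n, nsymComul K (PowerSeries.coeff n f) =
    ∑ p ∈ antidiagonal n, PowerSeries.coeff p.1 f ⊗ₜ[K] PowerSeries.coeff p.2 f

variable (K)

/-- The map `f ↦ f ⊗ 1` on power series. -/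
def seriesLeft : PowerSeries (NSym K) →+* PowerSeries (NSym K ⊗[K] NSym K) :=
  PowerSeries.map
    (Algebra.TensorProduct.includeLeft : NSym K →ₐ[K] NSym K ⊗[K] NSym K).toRingHom

/-- The map `f ↦ 1 ⊗ f` on power series. -/
def seriesRight : PowerSeries (NSym K) →+* PowerSeries (NSym K ⊗[K] NSym K) :=
  PowerSeries.map
    (Algebra.TensorProduct.includeRight : NSym K →ₐ[K] NSym K ⊗[K] NSym K).toRingHom

/-- The coproduct on power series. -/
def seriesComul : PowerSeries (NSym K) →+* PowerSeries (NSym K ⊗[K] NSym K) :=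
  PowerSeries.map (nsymComul K).toRingHom

variable {K}

theorem coeff_seriesLeft_mul_seriesRight (f g : PowerSeries (NSym K)) (n : ℕ) :
    PowerSeries.coeff n (seriesLeft K f * seriesRight K g) =
      ∑ p ∈ antidiagonal n, PowerSeries.coeff p.1 f ⊗ₜ[K] PowerSeries.coeff p.2 g := by
  simp [PowerSeries.coeff_mul, seriesLeft, seriesRight]

theorem seriesRight_mul_seriesLeft (f g : PowerSeries (NSym K)) :
    seriesRight K g * seriesLeft K f = seriesLeft K f * seriesRight K g := by
  ext n
  rw [coeff_seriesLeft_mul_seriesRight, PowerSeries.coeff_mul,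
    ← Finset.Nat.sum_antidiagonal_swap]
  simp [seriesLeft, seriesRight]

/-- Group-likeness as one identity, Δf = (f ⊗ 1)(1 ⊗ f), between power series over the tensor
square; closure under products and inverses then becomes ring algebra, as the two factors commute.
-/
theorem isDividedPower_iff (f : PowerSeries (NSym K)) :
    IsDividedPower f ↔ seriesComul K f = seriesLeft K f * seriesRight K f := by
  rw [PowerSeries.ext_iff]
  simp only [coeff_seriesLeft_mul_seriesRight]
  simp [IsDividedPower, seriesComul]

theorem isDividedPower_completeSeries : IsDividedPower (completeSeries K) := fun n => by
  simp only [coeff_completeSeries, nsymComul_complete]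

theorem IsDividedPower.mul {f g : PowerSeries (NSym K)} (hf : IsDividedPower f)
    (hg : IsDividedPower g) : IsDividedPower (f * g) := by
  rw [isDividedPower_iff] at *
  rw [map_mul, map_mul, map_mul, hf, hg, mul_assoc, ← mul_assoc (seriesRight K f),
    seriesRight_mul_seriesLeft]
  simp only [mul_assoc]

/-- Both Δg and (g ⊗ 1)(1 ⊗ g) are inverse to Δf. -/
theorem IsDividedPower.of_mul_eq_one {f g : PowerSeries (NSym K)} (hf : IsDividedPower f)
    (hfg : f * g = 1) (hgf : g * f = 1) : IsDividedPower g := by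
  rw [isDividedPower_iff] at *
  have h1 : seriesComul K g * seriesComul K f = 1 := by rw [← map_mul, hgf, map_one]
  have h2 : seriesComul K f * (seriesLeft K g * seriesRight K g) = 1 := by
    rw [hf, ← seriesRight_mul_seriesLeft, mul_assoc, ← mul_assoc (seriesLeft K f), ← map_mul, hfg,
      map_one, one_mul, ← map_mul, hfg, map_one]
  exact left_inv_eq_right_inv h1 h2

theorem IsDividedPower.alt {f : PowerSeries (NSym K)} (hf : IsDividedPower f) :
    IsDividedPower (alt K f) := fun n => by
  simp only [coeff_alt, map_smul, hf n, Finset.smul_sum]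
  refine Finset.sum_congr rfl fun p hp => ?_
  rw [← Finset.HasAntidiagonal.mem_antidiagonal.1 hp, pow_add, TensorProduct.smul_tmul_smul]

variable (K)

/-- The generating series `λ(t) σ(t)` of the elements corresponding to the `Ξ̃^n`. -/
def peakSeries : PowerSeries (NSym K) := alt K (inverseSeries K) * completeSeries K

variable {K}

theorem isDividedPower_peakSeries : IsDividedPower (peakSeries K) :=
  ((isDividedPower_completeSeries.of_mul_eq_one completeSeries_mul_inverseSeries
    inverseSeries_mul_completeSeries).alt).mul isDividedPower_completeSeries

theorem coeff_zero_peakSeries : PowerSeries.coeff 0 (peakSeries K) = 1 := by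
  rw [peakSeries, PowerSeries.coeff_mul]
  simp only [Finset.Nat.antidiagonal_zero, Finset.sum_singleton, coeff_alt, coeff_zero_inverseSeries,
    coeff_completeSeries, complete]
  simp

/-- The product is σ(-t)⁻¹ σ(t) · σ(t)⁻¹ σ(-t), which collapses from the middle. -/
theorem peakSeries_mul_alt : peakSeries K * alt K (peakSeries K) = 1 := by
  rw [peakSeries, alt_mul, alt_alt, mul_assoc, ← mul_assoc (completeSeries K),
    completeSeries_mul_inverseSeries, one_mul, ← alt_mul, inverseSeries_mul_completeSeries, alt_one]

end

/-! ### The free Hopf subalgebra on the odd coefficients of the peak series. -/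

noncomputable section

variable (K : Type u) [Field K]

/-- The homomorphism from the free algebra on the odd positive integers to `NSym` that sends the
generator `n` to half the coefficient of `t ^ n` in `peakSeries`. -/
def oddHom : FreeAlgebra K {n : ℕ // Odd n} →ₐ[K] NSym K :=
  FreeAlgebra.lift K fun n => (1 / 2 : K) • PowerSeries.coeff (n : ℕ) (peakSeries K)

variable {K}

theorem oddHom_ι (n : {n : ℕ // Odd n}) : oddHom K (FreeAlgebra.ι K n) =
    (1 / 2 : K) • PowerSeries.coeff (n : ℕ) (peakSeries K) := by
  simp [oddHom]

theorem coeff_map_algHom {R S : Type*} [Ring R] [Algebra K R] [Ring S] [Algebra K S]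
    (φ : R →ₐ[K] S) (f : PowerSeries R) (n : ℕ) :
    PowerSeries.coeff n (PowerSeries.map (φ : R →+* S) f) = φ (PowerSeries.coeff n f) := by
  simp

variable [CharZero K]

/-- The series `(1 + y) / 2` is a multiple of its value at `-t` by `y` if `y(t) y(-t) = 1`; this
provides a left inverse of `oddHom`. -/
theorem oddHom_injective : Function.Injective (oddHom K) := by
  -- The factor 2 matches the factor 1/2 in `oddHom`; the values prescribed at even n play no role.
  obtain ⟨y, hy0, hyodd, hy⟩ := exists_mul_alt_eq_one (K := K)
    (R := FreeAlgebra K {n : ℕ // Odd n})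
    fun n => if h : Odd n then (2 : K) • FreeAlgebra.ι K ⟨n, h⟩ else 0
  have h2 : (2 : K) ≠ 0 := two_ne_zero
  let ρ : NSym K →ₐ[K] FreeAlgebra K {n : ℕ // Odd n} :=
    FreeAlgebra.lift K fun n => (1 / 2 : K) • PowerSeries.coeff (n + 1) y
  let M := PowerSeries.map (ρ : NSym K →+* FreeAlgebra K {n : ℕ // Odd n})
  have hM : M (completeSeries K) = (1 / 2 : K) • (1 + y) := by
    ext n
    rw [coeff_map_algHom, coeff_completeSeries, PowerSeries.coeff_smul, map_add]
    cases n with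
    | zero =>
      rw [hy0, PowerSeries.coeff_zero_one, ← two_smul K, smul_smul, one_div, inv_mul_cancel₀ h2,
        one_smul]
      exact map_one ρ
    | succ n =>
      rw [PowerSeries.coeff_one, if_neg (Nat.succ_ne_zero n), zero_add]
      simp [complete, ρ]
  have hy' : alt K y * y = 1 := by
    have := congrArg (alt K) hy
    rwa [alt_mul, alt_alt, alt_one] at this
  -- Since y(-t) y(t) = 1, one has (1 + y(-t)) y(t) = 1 + y(t).
  have h3 : M (completeSeries K) = alt K (M (completeSeries K)) * y := by
    rw [hM, alt_smul, alt_add, alt_one, smul_mul_assoc, add_mul, one_mul, hy', add_comm]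
  -- If σ(t) maps to s(t) = s(-t) y(t), then Ξ(t) = σ(-t)⁻¹ σ(t) maps to y.
  have h4 : M (peakSeries K) = y := by
    have h5 : M (peakSeries K) = alt K (M (inverseSeries K)) * M (completeSeries K) := by
      rw [peakSeries, map_mul]
      congr 1
      exact map_alt ρ _
    rw [h5, h3, ← mul_assoc, ← alt_mul, ← map_mul, inverseSeries_mul_completeSeries, map_one,
      alt_one, one_mul]
  have h6 : ρ.comp (oddHom K) = AlgHom.id K _ := by
    refine FreeAlgebra.hom_ext (funext fun n => ?_)
    have h7 : ρ (PowerSeries.coeff (n : ℕ) (peakSeries K)) = PowerSeries.coeff (n : ℕ) y := by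
      rw [← coeff_map_algHom]
      exact congrArg _ h4
    simp only [Function.comp_apply, AlgHom.coe_comp, oddHom_ι, map_smul, h7, AlgHom.coe_id, id_eq]
    rw [hyodd _ n.2, dif_pos n.2, smul_smul, one_div, inv_mul_cancel₀ h2, one_smul]
  exact Function.LeftInverse.injective (g := ρ) fun x => DFunLike.congr_fun h6 x

theorem coeff_peakSeries_mem (n : ℕ) : PowerSeries.coeff n (peakSeries K) ∈ (oddHom K).range := by
  refine coeff_mem_of_mul_alt_eq_one (K := K) coeff_zero_peakSeries peakSeries_mul_alt _
    (fun n hn => ?_) n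
  have h : oddHom K ((2 : K) • FreeAlgebra.ι K ⟨n, hn⟩) = PowerSeries.coeff n (peakSeries K) := by
    rw [map_smul, oddHom_ι, smul_smul, mul_one_div_cancel two_ne_zero, one_smul]
  exact ⟨_, h⟩

/-- For a group-like series with constant term 1 the antipode axiom expresses S(Ξ_n) through the
S(Ξ_a) with a < n and the Ξ_b. -/
theorem nsymAntipode_peakSeries_mem (n : ℕ) :
    nsymAntipode K (PowerSeries.coeff n (peakSeries K)) ∈ (oddHom K).range := by
  induction n using Nat.strong_induction_on with
  | _ n ih =>
  have h1 := mul_rTensor_comul (PowerSeries.coeff n (peakSeries K))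
  rw [isDividedPower_peakSeries n, map_sum, map_sum] at h1
  simp only [LinearMap.rTensor_tmul, LinearMap.mul'_apply] at h1
  rw [← Finset.add_sum_erase _ _ (a := (n, 0)) (by simp)] at h1
  rw [coeff_zero_peakSeries, mul_one] at h1
  rw [eq_sub_of_add_eq h1]
  refine sub_mem (Subalgebra.algebraMap_mem _ _) (sum_mem ?_)
  rintro ⟨a, b⟩ hab
  rw [Finset.mem_erase, Finset.HasAntidiagonal.mem_antidiagonal] at hab
  refine mul_mem (ih a ?_) (coeff_peakSeries_mem b)
  obtain ⟨h2, h3⟩ := hab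
  simp only at h3
  by_contra h
  exact h2 (by ext <;> simp <;> omega)

theorem isHopfSubalgebra_oddHom_range : IsHopfSubalgebra (oddHom K).range where
  comul_mem := by
    rintro _ ⟨z, rfl⟩
    have h : nsymComul K (oddHom K z) ∈ (Algebra.TensorProduct.map (oddHom K).range.val
        (oddHom K).range.val).range := by
      induction z using FreeAlgebra.induction with
      | grade0 r =>
        rw [AlgHom.commutes, AlgHom.commutes]
        exact Subalgebra.algebraMap_mem _ _
      | grade1 n =>
        rw [oddHom_ι, map_smul, isDividedPower_peakSeries]
        refine Subalgebra.smul_mem _ (sum_mem fun p _ => ?_) _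
        exact ⟨⟨_, coeff_peakSeries_mem p.1⟩ ⊗ₜ ⟨_, coeff_peakSeries_mem p.2⟩, rfl⟩
      | mul a b ha hb =>
        rw [map_mul, map_mul]
        exact mul_mem ha hb
      | add a b ha hb =>
        rw [map_add, map_add]
        exact add_mem ha hb
    exact h
  antipode_mem := by
    rintro _ ⟨z, rfl⟩
    have h : nsymAntipode K (oddHom K z) ∈ (oddHom K).range := by
      induction z using FreeAlgebra.induction with
      | grade0 r =>
        rw [AlgHom.commutes, nsymAntipode_algebraMap]
        exact Subalgebra.algebraMap_mem _ _
      | grade1 n =>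
        rw [oddHom_ι, map_smul]
        exact Subalgebra.smul_mem _ (nsymAntipode_peakSeries_mem _) _
      | mul a b ha hb =>
        rw [map_mul, nsymAntipode_mul]
        exact mul_mem hb ha
      | add a b ha hb =>
        rw [map_add, map_add]
        exact add_mem ha hb
    exact h

end

/-! ### Words, their contents, and compatibility with the coproduct. -/

theorem castAdd_lt_castAdd_iff {n m : ℕ} (i j : Fin n) :
    Fin.castAdd m i < Fin.castAdd m j ↔ i < j := Iff.rfl

theorem natAdd_lt_natAdd_iff {n m : ℕ} (i j : Fin m) :
    Fin.natAdd n i < Fin.natAdd n j ↔ i < j := by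
  rw [Fin.lt_def, Fin.lt_def, Fin.val_natAdd, Fin.val_natAdd, Nat.add_lt_add_iff_left]

theorem seg_castAdd_lt_iff {n m : ℕ} (w : Equiv.Perm (Fin (n + m))) (i j : Fin n) :
    seg w 0 n i < seg w 0 n j ↔ w (Fin.castAdd m i) < w (Fin.castAdd m j) := by
  have h := letter_seg_lt_iff w (a := 0) (n := n) (by omega) (i := i + 1) (j := j + 1)
    (by omega) (by omega) (by omega) (by omega)
  have h1 := letter_fin w (Fin.castAdd m i)
  have h2 := letter_fin w (Fin.castAdd m j)
  simp only [Fin.val_castAdd] at h1 h2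
  rw [letter_fin, letter_fin, Nat.zero_add, Nat.zero_add, h1, h2] at h
  simpa using h

theorem seg_natAdd_lt_iff {n m : ℕ} (w : Equiv.Perm (Fin (n + m))) (i j : Fin m) :
    seg w n m i < seg w n m j ↔ w (Fin.natAdd n i) < w (Fin.natAdd n j) := by
  have h := letter_seg_lt_iff w (a := n) (n := m) (by omega) (i := i + 1) (j := j + 1)
    (by omega) (by omega) (by omega) (by omega)
  have h1 := letter_fin w (Fin.natAdd n i)
  have h2 := letter_fin w (Fin.natAdd n j)
  simp only [Fin.val_natAdd, Nat.add_assoc] at h1 h2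
  rw [letter_fin, letter_fin, h1, h2] at h
  simpa using h

/-- Ties are broken from left to right, and this rule is inherited by prefixes and suffixes, so
standardizing commutes with cutting a word. -/
theorem seg_stdPerm_left {α : Type*} [LinearOrder α] {n m : ℕ} (a : Fin (n + m) → α) :
    seg (stdPerm a) 0 n = stdPerm fun i => a (Fin.castAdd m i) := by
  refine perm_eq_of_lt_iff fun i j => ?_
  rw [seg_castAdd_lt_iff, stdPerm_lt_iff, stdPerm_lt_iff, castAdd_lt_castAdd_iff]

theorem seg_stdPerm_right {α : Type*} [LinearOrder α] {n m : ℕ} (a : Fin (n + m) → α) :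
    seg (stdPerm a) n m = stdPerm fun i => a (Fin.natAdd n i) := by
  refine perm_eq_of_lt_iff fun i j => ?_
  rw [seg_natAdd_lt_iff, stdPerm_lt_iff, stdPerm_lt_iff, natAdd_lt_natAdd_iff]

noncomputable section

/-- The number of occurrences of each letter in a word. -/
def content {r N : ℕ} (a : Fin N → Fin r) : Fin r →₀ ℕ := ∑ i, Finsupp.single (a i) 1

theorem content_append {r n m : ℕ} (a : Fin (n + m) → Fin r) :
    content a = content (fun i => a (Fin.castAdd m i)) + content (fun i => a (Fin.natAdd n i)) :=
  Fin.sum_univ_add _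

theorem degree_content {r N : ℕ} (a : Fin N → Fin r) : (content a).degree = N := by
  simp [content, map_sum]

theorem toMultiset_content {r N : ℕ} (a : Fin N → Fin r) :
    Finsupp.toMultiset (content a) = (List.ofFn a : Multiset (Fin r)) := by
  rw [content, map_sum]
  simp only [Finsupp.toMultiset_single, one_smul]
  rw [← Fin.univ_val_map]
  rw [← Multiset.sum_map_singleton (Multiset.map a Finset.univ.val), Multiset.map_map]
  rfl

theorem content_comp_perm {r N : ℕ} (a : Fin N → Fin r) (σ : Equiv.Perm (Fin N)) :
    content (a ∘ σ) = content a :=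
  Equiv.sum_comp σ fun i => Finsupp.single (a i) 1

theorem eq_of_monotone_of_content_eq {r N : ℕ} {a b : Fin N → Fin r} (ha : Monotone a)
    (hb : Monotone b) (h : content a = content b) : a = b := by
  have h1 := congrArg Finsupp.toMultiset h
  rw [toMultiset_content, toMultiset_content, Multiset.coe_eq_coe] at h1
  exact List.ofFn_injective (h1.eq_of_pairwise' ha.sortedLE_ofFn.pairwise hb.sortedLE_ofFn.pairwise)

variable (K : Type u) [Field K]

/-- The sum of the inverse standardizations of all words of length `N` with content `c`. -/
def wordSum {r : ℕ} (N : ℕ) (c : Fin r →₀ ℕ) : KS K :=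
  ∑ a : Fin N → Fin r, if content a = c then perm K (Tuple.sort a) else 0

/-- The sum of all permutations that increase on the fibres of `m`. -/
def blockSum {r N : ℕ} (m : Fin N → Fin r) : MR K :=
  mrOf K N fun w => if ∀ i j, i < j → m i = m j → w i < w j then 1 else 0

/-- The product of complete functions with given exponents. -/
def completeProd {r : ℕ} (c : Fin r →₀ ℕ) : NSym K := (List.ofFn fun i => complete K (c i)).prod

/-- The homomorphism from `NSym` to `MR K` sending complete functions to increasing
permutations. -/
def toMR : NSym K →ₐ[K] MR K := FreeAlgebra.lift K fun n => incr K (n + 1)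

variable {K}

theorem toMR_complete (n : ℕ) : toMR K (complete K n) = incr K n := by
  cases n with
  | zero => rw [incr_zero]; exact map_one _
  | succ n => simp [toMR, complete]

theorem wordSum_eq_zero {r N : ℕ} {c : Fin r →₀ ℕ} (h : N ≠ c.degree) : wordSum K N c = 0 := by
  refine Finset.sum_eq_zero fun a _ => if_neg ?_
  rintro rfl
  exact h (degree_content a).symm

/-- The rearrangements of the weakly increasing word m are the words m ∘ w⁻¹. Exactly one w giving a
fixed rearrangement increases on the blocks of m, namely its stable sorting permutation. -/
theorem toKS_blockSum {r N : ℕ} {m : Fin N → Fin r} (hm : Monotone m) :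
    toKS K (blockSum K m) = wordSum K N (content m) := by
  classical
  rw [blockSum, toKS_mrOf, ofCoeff, wordSum]
  simp only [ite_smul, one_smul, zero_smul]
  rw [← Finset.sum_filter, ← Finset.sum_filter]
  refine Finset.sum_nbij' (fun w => m ∘ w.symm) (fun a => Tuple.sort a) ?_ ?_ ?_ ?_ ?_
  · intro w _
    simp [content_comp_perm]
  · intro a ha
    have h1 : a ∘ Tuple.sort a = m := eq_of_monotone_of_content_eq (Tuple.monotone_sort a) hm
      ((content_comp_perm a _).trans (by simpa using ha))
    have h2 := (Tuple.eq_sort_iff (f := a) (σ := Tuple.sort a)).1 rfl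
    simp only [Finset.mem_filter, Finset.mem_univ, true_and]
    intro i j hij hm'
    rw [← h1] at hm'
    exact h2.2 i j hij hm'
  · intro w hw
    simp only [Finset.mem_filter, Finset.mem_univ, true_and] at hw
    symm
    rw [Tuple.eq_sort_iff]
    constructor
    · intro i j hij
      simpa using hm hij
    · intro i j hij h
      exact hw i j hij (by simpa using h)
  · intro a ha
    have h1 : a ∘ Tuple.sort a = m := eq_of_monotone_of_content_eq (Tuple.monotone_sort a) hm
      ((content_comp_perm a _).trans (by simpa using ha))
    ext1 i
    simp [← h1]
  · intro w hw
    simp only [Finset.mem_filter, Finset.mem_univ, true_and] at hw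
    congr 1
    rw [Tuple.eq_sort_iff]
    constructor
    · intro i j hij
      simpa using hm hij
    · intro i j hij h
      exact hw i j hij (by simpa using h)

theorem eq_one_iff_forall_lt {n : ℕ} (σ : Equiv.Perm (Fin n)) :
    σ = 1 ↔ ∀ i j, i < j → σ i < σ j := by
  constructor
  · rintro rfl i j h
    exact h
  · intro h
    have h1 : StrictMono σ := fun i j hij => h i j hij
    exact perm_eq_of_lt_iff fun i j => by simp [h1.lt_iff_lt]

theorem forall_append_iff {r n N : ℕ} (m : Fin N → Fin r) (w : Equiv.Perm (Fin (n + N))) :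
    (∀ i j, i < j → (Fin.append (fun _ => 0) (fun i => (m i).succ) : Fin (n + N) → Fin (r + 1)) i =
        (Fin.append (fun _ => 0) (fun i => (m i).succ) : Fin (n + N) → Fin (r + 1)) j → w i < w j) ↔
      (seg w 0 n = 1 ∧ ∀ i j, i < j → m i = m j → seg w n N i < seg w n N j) := by
  rw [eq_one_iff_forall_lt]
  simp only [seg_castAdd_lt_iff, seg_natAdd_lt_iff]
  constructor
  · intro h
    refine ⟨fun i j hij => h _ _ ((castAdd_lt_castAdd_iff i j).2 hij) (by simp),
      fun i j hij hm => h _ _ ((natAdd_lt_natAdd_iff i j).2 hij) (by simp [hm])⟩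
  · rintro ⟨h1, h2⟩ i j
    refine Fin.addCases (fun i => ?_) (fun i => ?_) i
    · refine Fin.addCases (fun j => ?_) (fun j => ?_) j
      · intro hij _
        exact h1 i j ((castAdd_lt_castAdd_iff i j).1 hij)
      · intro _ h
        simp only [Fin.append_left, Fin.append_right] at h
        exact absurd h.symm (Fin.succ_ne_zero _)
    · refine Fin.addCases (fun j => ?_) (fun j => ?_) j
      · intro _ h
        simp only [Fin.append_left, Fin.append_right] at h
        exact absurd h (Fin.succ_ne_zero _)
      · intro hij h
        exact h2 i j ((natAdd_lt_natAdd_iff i j).1 hij) (by simpa using h)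

theorem content_append_succ {r n N : ℕ} (m : Fin N → Fin r) :
    content (Fin.append (fun _ => 0) (fun i => (m i).succ) : Fin (n + N) → Fin (r + 1)) =
      Finsupp.cons n (content m) := by
  rw [content_append]
  ext x
  simp only [Fin.append_left, Fin.append_right, content, Finsupp.add_apply, Finsupp.finsetSum_apply]
  refine Fin.cases ?_ (fun x => ?_) x
  · simp
  · simp [Finsupp.single_apply, Fin.ext_iff]

theorem monotone_append_succ {r n N : ℕ} {m : Fin N → Fin r} (hm : Monotone m) :
    Monotone (Fin.append (fun _ => 0) (fun i => (m i).succ) : Fin (n + N) → Fin (r + 1)) := by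
  intro i j
  refine Fin.addCases (fun i => ?_) (fun i => ?_) i
  · intro _
    simp
  · refine Fin.addCases (fun j => ?_) (fun j => ?_) j
    · intro h
      rw [Fin.le_def, Fin.val_natAdd, Fin.val_castAdd] at h
      omega
    · intro h
      have : i ≤ j := by
        rw [Fin.le_def, Fin.val_natAdd, Fin.val_natAdd] at h
        exact Nat.le_of_add_le_add_left h
      simpa using hm this

theorem completeProd_cons {r : ℕ} (n : ℕ) (c : Fin r →₀ ℕ) :
    completeProd K (Finsupp.cons n c) = complete K n * completeProd K c := by
  simp [completeProd, List.ofFn_succ]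

/-- A product of increasing permutations is the sum of all w that increase on consecutive blocks of
the given lengths; m names the block of each position. Empty blocks are allowed because H_0 = 1. -/
theorem exists_toMR_completeProd {r : ℕ} (c : Fin r →₀ ℕ) : ∃ (N : ℕ) (m : Fin N → Fin r),
    Monotone m ∧ content m = c ∧ toMR K (completeProd K c) = blockSum K m := by
  induction r with
  | zero =>
    refine ⟨0, Fin.elim0, fun i => i.elim0, Subsingleton.elim _ _, ?_⟩
    simp only [completeProd, List.ofFn_zero, List.prod_nil, map_one, blockSum]
    rw [← mrOf_one]
    congr 1
  | succ r ih =>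
    obtain ⟨N, m, hm, hc, he⟩ := ih c.tail
    refine ⟨c 0 + N, Fin.append (fun _ => 0) (fun i => (m i).succ), monotone_append_succ hm, ?_, ?_⟩
    · rw [content_append_succ, hc, Finsupp.cons_tail]
    · conv_lhs => rw [← Finsupp.cons_tail c]
      rw [completeProd_cons, map_mul, he, toMR_complete, incr_eq, blockSum, mrOf_mul, blockSum]
      congr 1
      ext w
      simp only [forall_append_iff, ite_and]
      split_ifs <;> simp

theorem toKS_toMR_completeProd {r : ℕ} (c : Fin r →₀ ℕ) :
    toKS K (toMR K (completeProd K c)) = wordSum K c.degree c := by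
  obtain ⟨N, m, hm, hc, he⟩ := exists_toMR_completeProd (K := K) c
  rw [he, toKS_blockSum hm, hc, ← hc, degree_content]

theorem coprod_perm {N : ℕ} (π : Equiv.Perm (Fin N)) : coprod K (perm K π) =
    ∑ p ∈ antidiagonal N, ∑ α : Equiv.Perm (Fin p.1), ∑ β : Equiv.Perm (Fin p.2),
      if IsSplit π⁻¹ α⁻¹ β⁻¹ then perm K α ⊗ₜ[K] perm K β else 0 := by
  simp [coprod, perm, coprodPerm]

/-- The inverse of `Tuple.sort a` is the standardization of the word a, so for given k and l its
only splitting comes from cutting a after k letters. -/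
theorem sum_isSplit_sort {r k l : ℕ} (a : Fin (k + l) → Fin r) :
    (∑ α : Equiv.Perm (Fin k), ∑ β : Equiv.Perm (Fin l),
      if IsSplit (Tuple.sort a)⁻¹ α⁻¹ β⁻¹ then perm K α ⊗ₜ[K] perm K β else 0) =
      perm K (Tuple.sort fun i => a (Fin.castAdd l i)) ⊗ₜ[K]
        perm K (Tuple.sort fun i => a (Fin.natAdd k i)) := by
  have h : ∀ (α : Equiv.Perm (Fin k)) (β : Equiv.Perm (Fin l)),
      IsSplit (Tuple.sort a)⁻¹ α⁻¹ β⁻¹ ↔ α = Tuple.sort (fun i => a (Fin.castAdd l i)) ∧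
        β = Tuple.sort (fun i => a (Fin.natAdd k i)) := fun α β => by
    rw [isSplit_iff]
    have h1 := seg_stdPerm_left a
    have h2 := seg_stdPerm_right a
    simp only [stdPerm] at h1 h2
    rw [h1, h2, inv_inj, inv_inj]
  simp only [h]
  rw [Finset.sum_eq_single (Tuple.sort fun i => a (Fin.castAdd l i)) (fun b _ hb => by simp [hb])
    (by simp), Finset.sum_eq_single (Tuple.sort fun i => a (Fin.natAdd k i))
    (fun b _ hb => by simp [hb]) (by simp)]
  simp

theorem sum_word_split {r k l : ℕ} (c : Fin r →₀ ℕ) :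
    (∑ a : Fin (k + l) → Fin r, if content a = c then
      perm K (Tuple.sort fun i => a (Fin.castAdd l i)) ⊗ₜ[K]
        perm K (Tuple.sort fun i => a (Fin.natAdd k i)) else 0) =
      ∑ q ∈ antidiagonal c, wordSum K k q.1 ⊗ₜ[K] wordSum K l q.2 := by
  rw [← Equiv.sum_comp (Fin.appendEquiv (α := Fin r) k l) fun a => if content a = c then
      perm K (Tuple.sort fun i => a (Fin.castAdd l i)) ⊗ₜ[K]
        perm K (Tuple.sort fun i => a (Fin.natAdd k i)) else 0, Fintype.sum_prod_type]
  have h0 : ∀ q : (Fin r →₀ ℕ) × (Fin r →₀ ℕ), wordSum K k q.1 ⊗ₜ[K] wordSum K l q.2 =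
      ∑ a : Fin k → Fin r, ∑ b : Fin l → Fin r,
        (if content a = q.1 then perm K (Tuple.sort a) else 0) ⊗ₜ[K]
          (if content b = q.2 then perm K (Tuple.sort b) else 0) := fun q => by
    simp only [wordSum, TensorProduct.sum_tmul]
    exact Finset.sum_congr rfl fun a _ => TensorProduct.tmul_sum _ _ _
  simp only [h0]
  symm
  rw [Finset.sum_comm]
  refine Finset.sum_congr rfl fun a _ => ?_
  rw [Finset.sum_comm]
  refine Finset.sum_congr rfl fun b _ => ?_
  symm
  have h1 : content (Fin.appendEquiv k l (a, b)) = content a + content b := by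
    rw [content_append]
    simp [Fin.appendEquiv]
  rw [h1]
  by_cases h : content a + content b = c
  · rw [if_pos h, Finset.sum_eq_single (content a, content b)]
    · simp [Fin.appendEquiv]
    · rintro ⟨x, y⟩ _ hne
      by_cases hx : content a = x
      · have hy : content b ≠ y := fun hy => hne (by rw [hx, hy])
        simp [hy]
      · simp [hx]
    · intro h'
      exact absurd (Finset.HasAntidiagonal.mem_antidiagonal.2 h) h'
  · rw [if_neg h, Finset.sum_eq_zero]
    rintro ⟨x, y⟩ hxy
    rw [Finset.HasAntidiagonal.mem_antidiagonal] at hxy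
    by_cases hx : content a = x
    · have hy : content b ≠ y := fun hy => h (by rw [hx, hy]; exact hxy)
      simp [hy]
    · simp [hx]

/-- Cutting all words of content c in all ways gives all pairs of words whose contents add up to c.
The contents fix the two lengths, so the summation over lengths disappears. -/
theorem coprod_wordSum {r : ℕ} (c : Fin r →₀ ℕ) : coprod K (wordSum K c.degree c) =
    ∑ q ∈ antidiagonal c, wordSum K q.1.degree q.1 ⊗ₜ[K] wordSum K q.2.degree q.2 := by
  have h1 : coprod K (wordSum K c.degree c) = ∑ p ∈ antidiagonal c.degree,
      ∑ q ∈ antidiagonal c, wordSum K p.1 q.1 ⊗ₜ[K] wordSum K p.2 q.2 := by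
    rw [wordSum, map_sum]
    simp only [apply_ite (coprod K), map_zero, coprod_perm]
    have h2 : ∀ a : Fin c.degree → Fin r, (if content a = c then
        ∑ p ∈ antidiagonal c.degree, ∑ α : Equiv.Perm (Fin p.1), ∑ β : Equiv.Perm (Fin p.2),
          if IsSplit (Tuple.sort a)⁻¹ α⁻¹ β⁻¹ then perm K α ⊗ₜ[K] perm K β else 0
        else 0) = ∑ p ∈ antidiagonal c.degree, if content a = c then
          ∑ α : Equiv.Perm (Fin p.1), ∑ β : Equiv.Perm (Fin p.2),
          if IsSplit (Tuple.sort a)⁻¹ α⁻¹ β⁻¹ then perm K α ⊗ₜ[K] perm K β else 0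
        else 0 := fun a => by
      split_ifs
      · rfl
      · simp
    simp only [h2]
    rw [Finset.sum_comm]
    refine Finset.sum_congr rfl ?_
    rintro ⟨k, l⟩ hkl
    rw [Finset.HasAntidiagonal.mem_antidiagonal] at hkl
    simp only at hkl
    generalize c.degree = N at hkl
    subst hkl
    simp only [sum_isSplit_sort]
    exact sum_word_split c
  rw [h1, Finset.sum_comm]
  refine Finset.sum_congr rfl ?_
  rintro ⟨x, y⟩ hxy
  rw [Finset.HasAntidiagonal.mem_antidiagonal] at hxy
  simp only at hxy
  rw [Finset.sum_eq_single (x.degree, y.degree)]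
  · rintro ⟨k, l⟩ _ hne
    simp only
    by_cases hk : k = x.degree
    · have hl : l ≠ y.degree := fun hl => hne (by rw [hk, hl])
      rw [wordSum_eq_zero hl, TensorProduct.tmul_zero]
    · rw [wordSum_eq_zero hk, TensorProduct.zero_tmul]
  · intro h
    refine absurd ?_ h
    rw [Finset.HasAntidiagonal.mem_antidiagonal, ← hxy, map_add]

theorem sum_antidiagonal_cons {M : Type*} [AddCommMonoid M] {r : ℕ} (n : ℕ) (c : Fin r →₀ ℕ)
    (F : (Fin (r + 1) →₀ ℕ) → (Fin (r + 1) →₀ ℕ) → M) :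
    ∑ q ∈ antidiagonal (Finsupp.cons n c), F q.1 q.2 =
      ∑ p ∈ antidiagonal n, ∑ q ∈ antidiagonal c,
        F (Finsupp.cons p.1 q.1) (Finsupp.cons p.2 q.2) := by
  rw [← Finset.sum_product']
  refine Finset.sum_nbij' (fun q => ((q.1 0, q.2 0), (q.1.tail, q.2.tail)))
    (fun x => (Finsupp.cons x.1.1 x.2.1, Finsupp.cons x.1.2 x.2.2)) ?_ ?_ ?_ ?_ ?_
  · rintro ⟨x, y⟩ h
    simp only [Finset.mem_product, Finset.HasAntidiagonal.mem_antidiagonal] at h ⊢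
    constructor
    · have := DFunLike.congr_fun h 0
      simpa using this
    · ext i
      have := DFunLike.congr_fun h i.succ
      simpa [Finsupp.tail_apply] using this
  · rintro ⟨⟨a, b⟩, ⟨x, y⟩⟩ h
    simp only [Finset.mem_product, Finset.HasAntidiagonal.mem_antidiagonal] at h ⊢
    obtain ⟨rfl, rfl⟩ := h
    ext i
    refine Fin.cases ?_ (fun i => ?_) i <;> simp
  · rintro ⟨x, y⟩ _
    simp
  · rintro ⟨⟨a, b⟩, ⟨x, y⟩⟩ _
    simp
  · rintro ⟨x, y⟩ _
    simp

theorem nsymComul_completeProd {r : ℕ} (c : Fin r →₀ ℕ) : nsymComul K (completeProd K c) =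
    ∑ q ∈ antidiagonal c, completeProd K q.1 ⊗ₜ[K] completeProd K q.2 := by
  induction r with
  | zero =>
    have hc : c = 0 := Subsingleton.elim _ _
    subst hc
    simp [completeProd, Algebra.TensorProduct.one_def]
  | succ r ih =>
    rw [← Finsupp.cons_tail c, sum_antidiagonal_cons _ _
      fun x y => completeProd K x ⊗ₜ[K] completeProd K y, completeProd_cons, map_mul, ih,
      nsymComul_complete, Finset.sum_mul_sum]
    simp only [completeProd_cons, Algebra.TensorProduct.tmul_mul_tmul]

theorem span_completeProd : Submodule.span K
    {x : NSym K | ∃ (r : ℕ) (c : Fin r →₀ ℕ), x = completeProd K c} = ⊤ := by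
  have h1 : Algebra.adjoin K (Set.range (complete K)) = ⊤ := by
    rw [eq_top_iff]
    intro x _
    induction x using nsym_induction with
    | scalar r => exact Subalgebra.algebraMap_mem _ r
    | gen n => exact Algebra.subset_adjoin ⟨n, rfl⟩
    | mul a b ha hb => exact mul_mem (ha trivial) (hb trivial)
    | add a b ha hb => exact add_mem (ha trivial) (hb trivial)
  rw [eq_top_iff, ← Algebra.top_toSubmodule, ← h1, Algebra.adjoin_eq_span]
  refine Submodule.span_mono fun x hx => ?_
  obtain ⟨l, hl, rfl⟩ := Submonoid.exists_list_of_mem_closure hx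
  choose f hf using fun i : Fin l.length => hl (l.get i) (List.get_mem l i)
  refine ⟨l.length, Finsupp.equivFunOnFinite.symm f, ?_⟩
  rw [completeProd]
  congr 1
  simp only [Finsupp.coe_equivFunOnFinite_symm, hf]
  exact (List.ofFn_get l).symm

variable (K)

/-- The embedding of `NSym` into `KS K`. -/
def nsymToKS : NSym K →ₗ[K] KS K := (toKS K).toLinearMap ∘ₗ (toMR K).toLinearMap

variable {K}

/-- Both coproducts distribute a content vector in the same way, and the products of complete
functions span. No multiplicativity of ↓ on all of KS is needed. -/
theorem coprod_nsymToKS (x : NSym K) :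
    TensorProduct.map (nsymToKS K) (nsymToKS K) (nsymComul K x) = coprod K (nsymToKS K x) := by
  have hx : x ∈ Submodule.span K
      {x : NSym K | ∃ (r : ℕ) (c : Fin r →₀ ℕ), x = completeProd K c} := by
    rw [span_completeProd]
    trivial
  have key : ∀ {r : ℕ} (c : Fin r →₀ ℕ),
      nsymToKS K (completeProd K c) = wordSum K c.degree c := toKS_toMR_completeProd
  induction hx using Submodule.span_induction with
  | mem x h =>
    obtain ⟨r, c, rfl⟩ := h
    rw [nsymComul_completeProd, map_sum, key, coprod_wordSum]
    simp only [TensorProduct.map_tmul, key]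
  | zero => simp
  | add x y _ _ hx hy => simp only [map_add, hx, hy]
  | smul a x _ hx => simp only [map_smul, hx]

theorem counit_outerMul (x y : KS K) :
    counit K (outerMul K x y) = counit K x * counit K y := by
  induction x using KS_induction with
  | hadd x x' hx hx' => simp [hx, hx', add_mul]
  | hcoeff n f =>
  induction y using KS_induction with
  | hadd x x' hx hx' => simp [hx, hx', mul_add]
  | hcoeff m g =>
  have h : ∀ (n : ℕ) (f : Equiv.Perm (Fin n) → K), counit K (ofCoeff K n f) =
      ofCoeff K n f ⟨0, 1⟩ := fun n f => rfl
  rw [outerMul_ofCoeff, h, h, h]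
  rcases Nat.eq_zero_or_pos n with rfl | hn
  · rcases Nat.eq_zero_or_pos m with rfl | hm
    · rw [ofCoeff_apply, ofCoeff_apply, ofCoeff_apply]
      congr 2 <;> exact Subsingleton.elim _ _
    · rw [ofCoeff_apply_of_ne _ _ (by omega), ofCoeff_apply_of_ne (n := m) _ _ (by omega), mul_zero]
  · rw [ofCoeff_apply_of_ne _ _ (by omega), ofCoeff_apply_of_ne (n := n) _ _ (by omega), zero_mul]

theorem counit_nsymToKS (x : NSym K) : nsymCounit K x = counit K (nsymToKS K x) := by
  have h1 : counit K (emptyPerm K) = 1 := by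
    change emptyPerm K ⟨0, 1⟩ = 1
    rw [emptyPerm_eq, ofCoeff_apply]
  induction x using nsym_induction with
  | scalar r =>
    rw [Algebra.algebraMap_eq_smul_one, map_smul, map_smul, map_smul, map_one]
    congr 1
    have : nsymToKS K 1 = emptyPerm K := map_one (toMR K)
    rw [this, h1]
  | gen n =>
    rw [nsymCounit_complete]
    have h2 : nsymToKS K (complete K n) = ofCoeff K n fun w => if w = 1 then 1 else 0 := by
      have := toMR_complete (K := K) n
      rw [incr_eq] at this
      exact this
    rw [h2]
    change _ = ofCoeff K n _ ⟨0, 1⟩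
    rcases Nat.eq_zero_or_pos n with rfl | hn
    · rw [ofCoeff_apply]
      simp
    · rw [ofCoeff_apply_of_ne _ _ hn.ne', if_neg hn.ne']
  | mul a b ha hb =>
    have h2 : nsymToKS K (a * b) = outerMul K (nsymToKS K a) (nsymToKS K b) := map_mul (toMR K) a b
    rw [h2, counit_outerMul, map_mul, ha, hb]
  | add a b ha hb => simp only [map_add, ha, hb]

end

/-! ### Injectivity of `nsymToKS` by triangularity. -/

noncomputable section

/-- At the witness of the smallest index in a relation, every other term of the relation vanishes.
-/
theorem linearIndependent_of_triangular {K ι X : Type*} [Field K] [LinearOrder ι] (v : ι → X →₀ K)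
    (h : ∀ i, ∃ x, v i x = 1 ∧ ∀ j, v j x ≠ 0 → j ≤ i) : LinearIndependent K v := by
  rw [linearIndependent_iff]
  intro l hl
  by_contra hne
  have hs : l.support.Nonempty := Finsupp.support_nonempty_iff.2 hne
  obtain ⟨x, hx1, hx⟩ := h (l.support.min' hs)
  have h1 := DFunLike.congr_fun hl x
  rw [Finsupp.linearCombination_apply, Finsupp.sum, Finsupp.finsetSum_apply,
    Finset.sum_eq_single (l.support.min' hs)] at h1
  · simp only [Finsupp.smul_apply, hx1, smul_eq_mul, mul_one, Finsupp.coe_zero,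
      Pi.zero_apply] at h1
    exact Finsupp.mem_support_iff.1 (l.support.min'_mem hs) h1
  · intro j hj hne
    have h2 : v j x = 0 := by
      by_contra h3
      exact hne (le_antisymm (hx j h3) (l.support.min'_le j hj))
    simp [h2]
  · intro h
    exact absurd (l.support.min'_mem hs) h

theorem exists_glue {m : ℕ} (n : ℕ) (τ : Equiv.Perm (Fin m)) : ∃ π : Equiv.Perm (Fin (n + m)),
    seg π 0 n = 1 ∧ seg π n m = τ ∧ ∀ i j, π (Fin.natAdd n j) < π (Fin.castAdd m i) := by
  refine ⟨stdPerm (Fin.append (fun i : Fin n => m + (i : ℕ)) fun j => (τ j : ℕ)), ?_, ?_, ?_⟩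
  · rw [seg_stdPerm_left]
    refine perm_eq_of_lt_iff fun i j => ?_
    rw [stdPerm_lt_iff]
    simp only [Fin.append_left, Equiv.Perm.coe_one, id_eq, Fin.lt_def]
    omega
  · rw [seg_stdPerm_right]
    refine perm_eq_of_lt_iff fun i j => ?_
    rw [stdPerm_lt_iff_of_injective]
    · simp
    · intro i j h
      simp only [Fin.append_right] at h
      exact τ.injective (Fin.ext h)
  · intro i j
    rw [stdPerm_lt_iff]
    left
    simp only [Fin.append_left, Fin.append_right]
    omega

variable {K : Type u} [Field K]

theorem incr_mul_apply (n : ℕ) (y : MR K) {N : ℕ} (w : Equiv.Perm (Fin N)) :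
    toKS K (incr K n * y) ⟨N, w⟩ =
      if n ≤ N ∧ seg w 0 n = 1 then toKS K y ⟨N - n, seg w n (N - n)⟩ else 0 := by
  rw [toKS_mul]
  generalize toKS K y = y
  have hn : toKS K (incr K n) = ofCoeff K n fun w => if w = 1 then 1 else 0 := by
    rw [incr_eq]
    rfl
  rw [hn]
  induction y using KS_induction with
  | hadd x y hx hy =>
    rw [map_add, Finsupp.add_apply, hx, hy, Finsupp.add_apply]
    split_ifs <;> simp
  | hcoeff m g =>
    rw [outerMul_ofCoeff]
    by_cases hN : n + m = N
    · subst hN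
      have h1 : ∀ k, k = m → ofCoeff K m g ⟨k, seg w n k⟩ = g (seg w n m) := by
        rintro _ rfl
        rw [ofCoeff_apply]
      rw [h1 _ (Nat.add_sub_cancel_left _ _), ofCoeff_apply]
      simp
    · rw [ofCoeff_apply_of_ne _ _ hN]
      split_ifs with h
      · rw [ofCoeff_apply_of_ne]
        omega
      · rfl

/-- The increasing permutations multiply to a basis that is triangular for the lexicographic
order. -/
theorem exists_leading_perm (l : List ℕ) : ∃ x : AllPerm,
    toKS K (l.map fun n => incr K (n + 1)).prod x = 1 ∧
      ∀ l' : List ℕ, toKS K (l'.map fun n => incr K (n + 1)).prod x ≠ 0 → l' ≤ l := by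
  induction l with
  | nil =>
    refine ⟨⟨0, 1⟩, ?_, fun l' h => ?_⟩
    · rw [List.map_nil, List.prod_nil, toKS_one, emptyPerm_eq, ofCoeff_apply]
    · cases l' with
      | nil => exact le_rfl
      | cons b r =>
        rw [List.map_cons, List.prod_cons, incr_mul_apply, if_neg (by omega)] at h
        exact absurd rfl h
  | cons a l ih =>
    obtain ⟨⟨m, τ⟩, h1, h2⟩ := ih
    -- The leading permutation starts with a + 1 increasing letters, all larger than the rest, and
    -- continues as the leading permutation of the tail. The length is a + 1 because the letter a
    -- stands for degree a + 1.
    obtain ⟨π, hπ1, hπ2, hπ3⟩ := exists_glue (a + 1) τ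
    have key : ∀ k, k = m → (⟨k, seg π (a + 1) k⟩ : AllPerm) = ⟨m, τ⟩ := by
      rintro _ rfl
      rw [hπ2]
    have key' := key _ (Nat.add_sub_cancel_left (a + 1) m)
    refine ⟨⟨a + 1 + m, π⟩, ?_, fun l' h => ?_⟩
    · rw [List.map_cons, List.prod_cons, incr_mul_apply, if_pos ⟨by omega, hπ1⟩, key', h1]
    · cases l' with
      | nil => exact not_lt.1 (List.not_lt_nil (a :: l))
      | cons b r =>
        rw [List.map_cons, List.prod_cons, incr_mul_apply] at h
        rcases lt_trichotomy b a with hb | rfl | hb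
        · have h3 : b :: r < a :: l := List.cons_lt_cons_iff.2 (Or.inl hb)
          exact le_of_lt h3
        · rw [if_pos ⟨by omega, hπ1⟩, key'] at h
          exact List.cons_le_cons b (h2 r h)
        · rw [if_neg] at h
          · exact absurd rfl h
          -- A longer increasing first block would cross the drop of π between positions a + 1 and a
          -- + 2.
          · rintro ⟨h3, h4⟩
            have h5 := letter_seg_lt_iff π (a := 0) (n := b + 1) (by omega) (i := a + 1)
              (j := a + 2) (by omega) (by omega) (by omega) (by omega)
            rw [h4, Nat.zero_add, Nat.zero_add] at h5
            have h6 := letter_fin (1 : Equiv.Perm (Fin (b + 1))) ⟨a, by omega⟩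
            have h7 := letter_fin (1 : Equiv.Perm (Fin (b + 1))) ⟨a + 1, by omega⟩
            have h8 := letter_fin π (Fin.castAdd m ⟨a, by omega⟩)
            have h9 := letter_fin π (Fin.natAdd (a + 1) ⟨0, by omega⟩)
            simp only [Equiv.Perm.coe_one, id_eq, Fin.val_castAdd, Fin.val_natAdd, Nat.add_zero]
              at h6 h7 h8 h9
            rw [h6, h7, h8, h9] at h5
            have h10 := Fin.lt_def.1 (hπ3 ⟨a, by omega⟩ ⟨0, by omega⟩)
            omega

theorem basisFreeMonoid_apply {X : Type*} (l : FreeMonoid X) :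
    FreeAlgebra.basisFreeMonoid K X l = (l.toList.map (FreeAlgebra.ι K)).prod := by
  have h : FreeAlgebra.basisFreeMonoid K X l =
      FreeAlgebra.equivMonoidAlgebraFreeMonoid.symm (MonoidAlgebra.of K (FreeMonoid X) l) := by
    simp [FreeAlgebra.basisFreeMonoid]
  rw [h]
  change MonoidAlgebra.lift K _ _ (FreeMonoid.lift (FreeAlgebra.ι K)) (MonoidAlgebra.of K _ l) = _
  rw [MonoidAlgebra.lift_of, FreeMonoid.lift_apply]

theorem nsymToKS_injective : Function.Injective (nsymToKS K) := by
  have h1 : LinearIndependent K fun l : List ℕ =>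
      toKS K (l.map fun n => incr K (n + 1)).prod :=
    linearIndependent_of_triangular _ exists_leading_perm
  have h2 : (fun l : List ℕ => toKS K (l.map fun n => incr K (n + 1)).prod) =
      fun l : List ℕ => nsymToKS K (FreeAlgebra.basisFreeMonoid K ℕ (FreeMonoid.ofList l)) := by
    ext1 l
    rw [basisFreeMonoid_apply]
    change _ = toKS K (toMR K _)
    rw [map_list_prod (toMR K), List.map_map]
    congr 3
    ext1 n
    exact (toMR_complete (n + 1)).symm
  rw [h2] at h1
  rw [← LinearMap.ker_eq_bot, LinearMap.ker_eq_bot']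
  intro x hx
  have h3 := (FreeAlgebra.basisFreeMonoid K ℕ).linearCombination_repr x
  rw [← h3, Finsupp.apply_linearCombination] at hx
  have h4 := linearIndependent_iff.1 h1 ((FreeAlgebra.basisFreeMonoid K ℕ).repr x) hx
  exact (FreeAlgebra.basisFreeMonoid K ℕ).repr.map_eq_zero_iff.1 h4

end

/-! ### Identification with the descent and peak algebras, and the basis of odd words. -/

noncomputable section

section

variable {K : Type u} [Field K]

theorem range_toMR : (toMR K).range = statAlg isLocalStat_Des := by
  rw [statAlg_Des_eq]
  refine le_antisymm ?_ (Algebra.adjoin_le ?_)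
  · rintro _ ⟨x, rfl⟩
    have h : toMR K x ∈ Algebra.adjoin K (Set.range fun n => statSum K Des n ∅) := by
      induction x using nsym_induction with
      | scalar r =>
        rw [AlgHom.commutes]
        exact Subalgebra.algebraMap_mem _ _
      | gen n =>
        rw [toMR_complete]
        exact Algebra.subset_adjoin ⟨n, rfl⟩
      | mul a b ha hb =>
        rw [map_mul]
        exact mul_mem ha hb
      | add a b ha hb =>
        rw [map_add]
        exact add_mem ha hb
    exact h
  · rintro _ ⟨n, rfl⟩
    exact ⟨complete K n, toMR_complete n⟩

theorem range_nsymToKS : LinearMap.range (nsymToKS K) = descentAlg K := by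
  rw [nsymToKS, LinearMap.range_comp, ← map_statSpace_Des, ← toSubmodule_statAlg isLocalStat_Des,
    ← range_toMR]
  rfl

/-- The signed series of decreasing permutations is a left inverse of the image of σ, and the image
of σ⁻¹ is a right inverse, so the two agree. -/
theorem map_series_peakSeries : PowerSeries.map (toMR K : NSym K →+* MR K) (peakSeries K) =
    PowerSeries.mk (decr K) * PowerSeries.mk (incr K) := by
  have h1 : PowerSeries.map (toMR K : NSym K →+* MR K) (completeSeries K) =
      PowerSeries.mk (incr K) := by
    ext1 n
    rw [coeff_map_algHom, coeff_completeSeries, toMR_complete, PowerSeries.coeff_mk]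
  have h2 : alt K (PowerSeries.mk (decr K)) * PowerSeries.mk (incr K) = 1 := by
    ext1 n
    rw [PowerSeries.coeff_mul, PowerSeries.coeff_one]
    simp only [coeff_alt, PowerSeries.coeff_mk]
    split_ifs with h
    · subst h
      simp [decr_zero, incr_zero]
    · exact alternating_sum_decr_mul_incr n (Nat.one_le_iff_ne_zero.2 h)
  have h3 : PowerSeries.mk (incr K) *
      PowerSeries.map (toMR K : NSym K →+* MR K) (inverseSeries K) = 1 := by
    rw [← h1, ← map_mul, completeSeries_mul_inverseSeries, map_one]
  rw [peakSeries, map_mul, h1, map_alt, ← left_inv_eq_right_inv h2 h3, alt_alt]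

theorem toMR_coeff_peakSeries {n : ℕ} (hn : 1 ≤ n) :
    toMR K (PowerSeries.coeff n (peakSeries K)) = (2 : K) • statSum K Peak n ∅ := by
  rw [← coeff_map_algHom, map_series_peakSeries, PowerSeries.coeff_mul]
  simp only [PowerSeries.coeff_mk]
  exact sum_decr_mul_incr n hn

theorem nsymToKS_coeff_peakSeries (n : ℕ) :
    nsymToKS K (PowerSeries.coeff n (peakSeries K)) = xiTilde K n := by
  rcases Nat.eq_zero_or_pos n with rfl | hn
  · rw [coeff_zero_peakSeries, xiTilde, if_pos rfl]
    exact map_one (toMR K)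
  · rw [xiTilde, if_neg hn.ne', ← toKS_statSum_Peak, ← map_smul, ← toMR_coeff_peakSeries hn]
    rfl

theorem coprod_xiTilde (n : ℕ) : coprod K (xiTilde K n) =
    ∑ k ∈ Finset.range (n + 1), xiTilde K k ⊗ₜ[K] xiTilde K (n - k) := by
  rw [← nsymToKS_coeff_peakSeries, ← coprod_nsymToKS, isDividedPower_peakSeries n, map_sum,
    Finset.Nat.sum_antidiagonal_eq_sum_range_succ_mk]
  simp only [TensorProduct.map_tmul, nsymToKS_coeff_peakSeries]

theorem xiTildeWord_eq (q : List ℕ+) : xiTildeWord K q =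
    toKS K (q.map fun n : ℕ+ => toMR K (PowerSeries.coeff (n : ℕ) (peakSeries K))).prod := by
  induction q with
  | nil => rfl
  | cons a q ih =>
    rw [List.map_cons, List.prod_cons, toKS_mul, ← ih]
    change outerMul K (xiTilde K a) (xiTildeWord K q) = _
    rw [← nsymToKS_coeff_peakSeries]
    rfl

theorem outerMul_xiTildeWord (r q : List ℕ+) :
    outerMul K (xiTildeWord K r) (xiTildeWord K q) = xiTildeWord K (r ++ q) := by
  rw [xiTildeWord_eq, xiTildeWord_eq, xiTildeWord_eq, ← toKS_mul, List.map_append,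
    List.prod_append]

theorem half_smul_xiTilde [CharZero K] {n : ℕ} (hn : Odd n) :
    (1 / 2 : K) • xiTilde K n = peakSum K n ∅ := by
  rw [xiTilde, if_neg hn.pos.ne', smul_smul, one_div, inv_mul_cancel₀ two_ne_zero, one_smul]

theorem identifiesHopf_nsymToKS : IdentifiesHopf (nsymToKS K) (descentAlg K) where
  injective := nsymToKS_injective
  range_eq := range_nsymToKS
  map_one := map_one (toMR K)
  map_mul := map_mul (toMR K)
  map_comul := coprod_nsymToKS
  map_counit := counit_nsymToKS

end

/-- A word with odd letters, as a monomial in the free monoid on the odd numbers. -/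
def oddWord (q : {q : List ℕ+ // ∀ a ∈ q, Odd (a : ℕ)}) : FreeMonoid {n : ℕ // Odd n} :=
  FreeMonoid.ofList (q.1.pmap (fun (a : ℕ+) h => ⟨(a : ℕ), h⟩) q.2)

theorem oddWord_injective : Function.Injective oddWord := by
  intro q q' h
  have h1 := congrArg (List.map Subtype.val) (congrArg FreeMonoid.toList h)
  simp only [oddWord, FreeMonoid.toList_ofList, List.map_pmap, List.pmap_eq_map] at h1
  exact Subtype.ext (List.map_injective_iff.2 PNat.coe_injective h1)

theorem oddWord_surjective : Function.Surjective oddWord := by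
  intro l
  refine ⟨⟨l.toList.map fun n => Nat.toPNat n.1 n.2.pos, ?_⟩, ?_⟩
  · intro a ha
    obtain ⟨n, -, rfl⟩ := List.mem_map.1 ha
    exact n.2
  · rw [oddWord]
    apply FreeMonoid.toList.injective
    rw [FreeMonoid.toList_ofList]
    apply List.map_injective_iff.2 Subtype.val_injective
    rw [List.map_pmap, List.pmap_eq_map]
    exact List.map_map

variable {K : Type u} [Field K] [CharZero K]

/-- Each generator of the free algebra stands for half of some Ξ̃^n, so a word of length k carries
the factor 2^k. This invertible rescaling turns the monomial basis into the odd words Ξ̃^q. -/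
theorem xiTildeWord_eq_smul (q : {q : List ℕ+ // ∀ a ∈ q, Odd (a : ℕ)}) : xiTildeWord K q.1 =
    (2 : K) ^ q.1.length •
      nsymToKS K (oddHom K (FreeAlgebra.basisFreeMonoid K _ (oddWord q))) := by
  rw [basisFreeMonoid_apply, xiTildeWord_eq]
  change _ = toKS K ((2 : K) ^ q.1.length • toMR K _)
  congr 1
  obtain ⟨q, hq⟩ := q
  simp only [oddWord, FreeMonoid.toList_ofList]
  induction q with
  | nil => simp
  | cons a q ih =>
    rw [List.map_cons, List.prod_cons, ih fun b hb => hq b (List.mem_cons_of_mem a hb)]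
    simp only [List.pmap_cons, List.map_cons, List.prod_cons, map_mul, oddHom_ι, map_smul,
      List.length_cons, smul_mul_assoc, mul_smul_comm, smul_smul]
    congr 1
    rw [pow_succ, mul_assoc, mul_one_div_cancel two_ne_zero, mul_one]

theorem linearIndependent_xiTildeWord : LinearIndependent K
    (fun q : {q : List ℕ+ // ∀ a ∈ q, Odd (a : ℕ)} => xiTildeWord K q.1) := by
  have h1 := (FreeAlgebra.basisFreeMonoid K {n : ℕ // Odd n}).linearIndependent.comp _
    oddWord_injective
  have h2 := h1.map' (nsymToKS K ∘ₗ (oddHom K).toLinearMap)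
    (LinearMap.ker_eq_bot.2 (nsymToKS_injective.comp oddHom_injective))
  have h3 := h2.units_smul fun q => Units.mk0 ((2 : K) ^ q.1.length) (pow_ne_zero _ two_ne_zero)
  rw [funext xiTildeWord_eq_smul]
  exact h3

theorem map_oddHom_range : (oddHom K).range.map (toMR K) = statAlg isLocalStat_Peak := by
  have h1 : ∀ n, 1 ≤ n → toMR K ((1 / 2 : K) • PowerSeries.coeff n (peakSeries K)) =
      statSum K Peak n ∅ := fun n hn => by
    rw [map_smul, toMR_coeff_peakSeries hn, smul_smul, one_div, inv_mul_cancel₀ two_ne_zero,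
      one_smul]
  rw [statAlg_Peak_eq]
  refine le_antisymm ?_ (Algebra.adjoin_le ?_)
  · rintro _ ⟨_, ⟨z, rfl⟩, rfl⟩
    have h : toMR K (oddHom K z) ∈
        Algebra.adjoin K (Set.range fun n => statSum K Peak n ∅) := by
      induction z using FreeAlgebra.induction with
      | grade0 r =>
        rw [AlgHom.commutes, AlgHom.commutes]
        exact Subalgebra.algebraMap_mem _ _
      | grade1 n =>
        rw [oddHom_ι, h1 _ n.2.pos]
        exact Algebra.subset_adjoin ⟨n, rfl⟩
      | mul a b ha hb =>
        rw [map_mul, map_mul]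
        exact mul_mem ha hb
      | add a b ha hb =>
        rw [map_add, map_add]
        exact add_mem ha hb
    exact h
  · rintro _ ⟨n, rfl⟩
    rcases Nat.eq_zero_or_pos n with rfl | hn
    -- Degree 0 is separate: Ξ̃^0 is ∅ itself and not 2 Π^∅.
    · have h2 : statSum K Peak 0 ∅ = 1 := by
        rw [← mrOf_one]
        rfl
      simp only [h2]
      exact one_mem _
    · exact ⟨_, Subalgebra.smul_mem _ (coeff_peakSeries_mem n) _, h1 n hn⟩

theorem map_nsymToKS_oddHom_range :
    Submodule.map (nsymToKS K) (Subalgebra.toSubmodule (oddHom K).range) = peakAlg K := by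
  rw [nsymToKS, Submodule.map_comp, ← map_statSpace_Peak, ← toSubmodule_statAlg isLocalStat_Peak,
    ← map_oddHom_range]
  rfl

theorem span_xiTildeWord : Submodule.span K (Set.range
    (fun q : {q : List ℕ+ // ∀ a ∈ q, Odd (a : ℕ)} => xiTildeWord K q.1)) = peakAlg K := by
  rw [← map_nsymToKS_oddHom_range]
  refine le_antisymm (Submodule.span_le.2 ?_) ?_
  · rintro _ ⟨q, rfl⟩
    simp only [xiTildeWord_eq_smul]
    exact Submodule.smul_mem _ _ ⟨_, ⟨_, rfl⟩, rfl⟩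
  · rintro _ ⟨_, ⟨z, rfl⟩, rfl⟩
    have hz := (FreeAlgebra.basisFreeMonoid K {n : ℕ // Odd n}).mem_span z
    change nsymToKS K (oddHom K z) ∈ _
    induction hz using Submodule.span_induction with
    | mem x h =>
      obtain ⟨l, rfl⟩ := h
      obtain ⟨q, rfl⟩ := oddWord_surjective l
      have h1 : nsymToKS K (oddHom K (FreeAlgebra.basisFreeMonoid K _ (oddWord q))) =
          ((2 : K) ^ q.1.length)⁻¹ • xiTildeWord K q.1 := by
        rw [xiTildeWord_eq_smul, smul_smul, inv_mul_cancel₀ (pow_ne_zero _ two_ne_zero), one_smul]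
      rw [h1]
      exact Submodule.smul_mem _ _ (Submodule.subset_span ⟨q, rfl⟩)
    | zero => simp
    | add x y _ _ hx hy =>
      rw [map_add, map_add]
      exact add_mem hx hy
    | smul a x _ hx =>
      rw [map_smul, map_smul]
      exact Submodule.smul_mem _ _ hx

end

end PeakHopf

theorem theorem3 {K : Type u} [Field K] [CharZero K] :
    -- `(𝒟, ⋆, ↓)` is a Hopf algebra `H`, `𝒫` is a Hopf subalgebra `A` of it, and `A` is freely
    -- generated, as an algebra, by the elements `½ Ξ̃^n`, `n` odd
    (∃ (H : Type u) (_ : Ring H) (_ : HopfAlgebra K H) (e : H →ₗ[K] PeakHopf.KS K),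
      PeakHopf.IdentifiesHopf e (PeakHopf.descentAlg K) ∧
      ∃ A : Subalgebra K H,
        Submodule.map e (Subalgebra.toSubmodule A) = PeakHopf.peakAlg K ∧
        PeakHopf.IsHopfSubalgebra A ∧
        ∃ φ : FreeAlgebra K {n : ℕ // Odd n} ≃ₐ[K] A, ∀ n : {n : ℕ // Odd n},
          e (φ (FreeAlgebra.ι K n) : H) = (1 / 2 : K) • PeakHopf.xiTilde K n) ∧
    (∀ n : ℕ, Odd n → (1 / 2 : K) • PeakHopf.xiTilde K n = PeakHopf.peakSum K n ∅) ∧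
    -- the elements `Ξ̃^q`, `q` odd, are a linear basis of `𝒫`
    LinearIndependent K
      (fun q : {q : List ℕ+ // ∀ a ∈ q, Odd (a : ℕ)} => PeakHopf.xiTildeWord K q.1) ∧
    Submodule.span K (Set.range
      (fun q : {q : List ℕ+ // ∀ a ∈ q, Odd (a : ℕ)} => PeakHopf.xiTildeWord K q.1)) =
      PeakHopf.peakAlg K ∧
    -- product and coproduct
    (∀ r q : List ℕ+, PeakHopf.outerMul K (PeakHopf.xiTildeWord K r) (PeakHopf.xiTildeWord K q) =
      PeakHopf.xiTildeWord K (r ++ q)) ∧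
    (∀ n : ℕ, PeakHopf.coprod K (PeakHopf.xiTilde K n) =
      ∑ k ∈ Finset.range (n + 1), PeakHopf.xiTilde K k ⊗ₜ[K] PeakHopf.xiTilde K (n - k)) := by
  refine ⟨⟨PeakHopf.NSym K, inferInstance, inferInstance, PeakHopf.nsymToKS K,
    PeakHopf.identifiesHopf_nsymToKS, (PeakHopf.oddHom K).range,
    PeakHopf.map_nsymToKS_oddHom_range, PeakHopf.isHopfSubalgebra_oddHom_range,
    AlgEquiv.ofInjective _ PeakHopf.oddHom_injective, fun n => ?_⟩,
    fun n hn => PeakHopf.half_smul_xiTilde hn, PeakHopf.linearIndependent_xiTildeWord,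
    PeakHopf.span_xiTildeWord, PeakHopf.outerMul_xiTildeWord, PeakHopf.coprod_xiTilde⟩
  rw [AlgEquiv.ofInjective_apply, PeakHopf.oddHom_ι, map_smul, PeakHopf.nsymToKS_coeff_peakSeries]
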